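/- Let $\Sigma$ be a finite alphabet. For words $s,t$ of the same length, $s\otimes t$ denotes the word over the product alphabet whose $i$-th letter is $(s[i],t[i])$. Let $\mathbb S\subseteq\Sigma^*$ be a regular language and let $F:2^{\Sigma^*}\to 2^{\Sigma^*}$ satisfy $F(X)\subseteq X$ for all $X$. Put $\mathbb S_0=\mathbb S$, $\mathbb S_{k+1}=F(\mathbb S_k)$; for $s,t\in\mathbb S$ let $s\preceq t$ mean that $s\in\mathbb S_k$ implies $t\in\mathbb S_k$ for all $k\in\mathbb N$, and let $L_\preceq=\{s\otimes t : |s|=|t|,\ s\preceq t\}\subseteq(\Sigma\times\Sigma)^*$. Assume that $F$ is * independently length-preserving: $F(X\cap\Sigma^l)=F(X)\cap\Sigma^l$ for all $l\in\mathbb N$ and $X\subseteq\Sigma^*$; * effectively uniformly regular: for every finite alphabet $\Sigma'$ and every regular $L\subseteq(\Sigma'\times\Sigma)^*$ the language $\{w'\otimes w_2 : |w'|=|w_2|,\ w_2\in F(\{w_1 : |w_1|=|w'|,\ w'\otimes w_1\in L\})\}$ is regular, and an automaton for it is computable from an automaton for $L$. Consider the following oracles. * Membership query $w=s\otimes t$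 with $|w|=l$: compute $T_0=\mathbb S\cap\Sigma^l$, $T_{k+1}=F(T_k)$ up to the first $k$ with $s\notin T_k$ or $t\notin T_k$ or $T_k=T_{k+1}$; answer "yes" if and only if $s,t\in\mathbb S$ and ($s\in T_k\Rightarrow t\in T_k$). * Equivalence query for an automaton recognizing $L\subseteq(\Sigma\times\Sigma)^*$: let $R=\{(s,t):|s|=|t|,\ s\otimes t\in L\}$ and ${\uparrow}_Rs=\{u\in\mathbb S:(s,u)\in R\}$. Say that $R$ is refuted at length $k$ if one of the following holds, with all quantified words in $\Sigma^k$: 1. $\exists s,t:\ (s,t)\in R$ and $(s,t)\notin\mathbb S\times\mathbb S$; 2. $\exists s\in\mathbb S:\ (s,s)\notin R$; 3. $\exists s_1,s_2,s_3:\ (s_1,s_2)\in R$, $(s_2,s_3)\in R$, $(s_1,s_3)\notin R$; 4. $\exists s,t\in\mathbb S:\ (s,t)\notin R$ and $(t,s)\notin R$; 5. $\exists s,t_1,t_2:\ (s,t_1)\in R$, $(s,t_2)\in R$, exactly one of the statements $(t_1,s)\notin R$ and $t_1\in F({\uparrow}_Rs)$ is true, and $(t_2,s)\notin R$ or $t_2\notin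 F({\uparrow}_Rs)$. If $R$ is refuted at no length, the candidate is accepted. Otherwise the answer is a word $w$ on which $L$ and the answer of the membership oracle differ, and at whose length $R$ is refuted. The learning procedure is Angluin's $L^*$ algorithm over the alphabet $\Sigma\times\Sigma$ run with these oracles: it starts from the observation table with the empty word as only prefix and only suffix; it extends the suffixes while the table is inconsistent and the prefixes while it is not closed; when the table is closed and consistent it conjectures the automaton of the table, adds all prefixes of a received counterexample to the table's prefixes, and returns the conjecture if it is accepted. All choices that $L^*$ or the equivalence oracle leave open are arbitrary. Then both oracles are computable: there is a computable function giving the answers to all membership queries, and a computable function giving an admissible answer to every equivalence query. The learning procedure terminates and returns an automaton recognizing $L_\preceq$ (on every run, whatever choices are made) if and only if $L_\preceq$ is regular. Moreover, whenever a run returns an automaton, this automaton recognizes $L_\preceq$. -/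

import Mathlib

universe u

namespace DisappearanceLearning

section Automata

/-- A finite description of a nondeterministic automaton over the alphabet `Γ`, with natural
numbers as states: the list of initial states, the list of transitions `(q, a, q')`, and the list
of accepting states. Every such triple of lists is an automaton. -/
abbrev AutomatonCode (Γ : Type u) : Type u :=
  List ℕ × List (ℕ × Γ × ℕ) × List ℕ

variable {Γ : Type u}

/-- The automaton described by a code. -/
def AutomatonCode.toNFA (c : AutomatonCode Γ) : NFA Γ ℕ where
  step q a := {q' | (q, a, q') ∈ c.2.1}
  start := {q | q ∈ c.1}
  accept := {q | q ∈ c.2.2}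

/-- The language recognized by the automaton described by a code. -/
def AutomatonCode.lang (c : AutomatonCode Γ) : Language Γ :=
  (AutomatonCode.toNFA c).accepts

end Automata

section Disappearance

variable {α : Type u}

/-- `X ∩ Σ ^ l`. -/
def restrictLength (X : Language α) (l : ℕ) : Language α :=
  {w | w ∈ X ∧ w.length = l}

/-- `F (X ∩ Σ ^ l) = F X ∩ Σ ^ l` for all lengths `l` and all languages `X`. -/
def IndependentlyLengthPreserving (F : Language α → Language α) : Prop :=
  ∀ (l : ℕ) (X : Language α), F (restrictLength X l) = restrictLength (F X) l

/-- For a language `L` of words `w' ⊗ w₁`, the language of all `w' ⊗ w₂`, with `|w'| = |w₂|`, such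
that `w₂ ∈ F {w₁ | w' ⊗ w₁ ∈ L}`. The synchronous product `⊗` of two words of the same length is
`List.zip`. -/
def uniformImage {β : Type u} (F : Language α → Language α) (L : Language (β × α)) :
    Language (β × α) :=
  {w | ∃ (w' : List β) (w₂ : List α), w'.length = w₂.length ∧ w = w'.zip w₂ ∧
    w₂ ∈ F {w₁ | w'.length = w₁.length ∧ w'.zip w₁ ∈ L}}

/-- For every alphabet `β`, the image of a regular language over `β × α` under `uniformImage F` is
regular, and an automaton for it is computable from an automaton for the given language. -/
def EffectivelyUniformlyRegular [Primcodable α] (F : Language α → Language α) : Prop :=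
  ∀ (β : Type u) [Fintype β] [Primcodable β],
    ∃ f : AutomatonCode (β × α) → AutomatonCode (β × α),
      Computable f ∧ ∀ c, AutomatonCode.lang (f c) = uniformImage F (AutomatonCode.lang c)

/-- The iterates `S₀ = S`, `Sₖ₊₁ = F Sₖ`. -/
def stateSpace (F : Language α → Language α) (S : Language α) (k : ℕ) : Language α :=
  F^[k] S

/-- The disappearance relation `s ≼ t` on `S`. -/
def Disappears (F : Language α → Language α) (S : Language α) (s t : List α) : Prop :=
  s ∈ S ∧ t ∈ S ∧ ∀ k : ℕ, s ∈ stateSpace F S k → t ∈ stateSpace F S k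

/-- `L_≼ = {s ⊗ t | |s| = |t|, s ≼ t}`. -/
def disappearanceLanguage (F : Language α → Language α) (S : Language α) : Language (α × α) :=
  {w | ∃ s t : List α, s.length = t.length ∧ w = s.zip t ∧ Disappears F S s t}

end Disappearance

section Oracles

variable {α : Type u}

/-- The condition that ends the loop answering a membership query for `s ⊗ t`: one of the two words
has left the `k`-th iterate started from `S ∩ Σ ^ |s|`, or the iterates have become stationary. -/
def MembershipLoopStops (F : Language α → Language α) (S : Language α) (s t : List α)
    (k : ℕ) : Prop :=
  s ∉ stateSpace F (restrictLength S s.length) k ∨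
  t ∉ stateSpace F (restrictLength S s.length) k ∨
  stateSpace F (restrictLength S s.length) k = stateSpace F (restrictLength S s.length) (k + 1)

/-- `b` is the answer of the membership oracle to the query `w = s ⊗ t`: compute the iterates
started from `S ∩ Σ ^ |w|` until the loop stops for the first time, say at stage `k`; the answer is
positive iff both words lie in `S` and it is not the case that `t` alone is missing at stage `k`. -/
def IsMembershipAnswer (F : Language α → Language α) (S : Language α) (w : List (α × α))
    (b : Bool) : Prop :=
  ∃ (s t : List α) (k : ℕ), s.length = t.length ∧ w = s.zip t ∧
    MembershipLoopStops F S s t k ∧ (∀ j < k, ¬ MembershipLoopStops F S s t j) ∧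
    (b = true ↔ s ∈ S ∧ t ∈ S ∧
      (s ∈ stateSpace F (restrictLength S s.length) k →
        t ∈ stateSpace F (restrictLength S s.length) k))

/-- The length-preserving relation `R` encoded by a language `L`. -/
def relOf (L : Language (α × α)) (s t : List α) : Prop :=
  s.length = t.length ∧ s.zip t ∈ L

/-- The upward closure `{u ∈ S | (s, u) ∈ R}`. -/
def upClosure (S : Language α) (R : List α → List α → Prop) (s : List α) : Language α :=
  {u | u ∈ S ∧ R s u}

/-- The first-order criterion, on words of length `k`, by which the equivalence oracle refutes a
candidate relation `R`: it is not contained in `S × S`, not reflexive on `S`, not transitive, not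
total on `S`, or, for some `s`, neither `[s] = ↑s \ F (↑s)` nor `[s] = ↑s = F (↑s)`. -/
def Refutes (F : Language α → Language α) (S : Language α) (R : List α → List α → Prop)
    (k : ℕ) : Prop :=
  (∃ s t : List α, s.length = k ∧ t.length = k ∧ R s t ∧ ¬ (s ∈ S ∧ t ∈ S)) ∨
  (∃ s : List α, s.length = k ∧ s ∈ S ∧ ¬ R s s) ∨
  (∃ s₁ s₂ s₃ : List α, s₁.length = k ∧ s₂.length = k ∧ s₃.length = k ∧
    R s₁ s₂ ∧ R s₂ s₃ ∧ ¬ R s₁ s₃) ∨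
  (∃ s t : List α, s.length = k ∧ t.length = k ∧ s ∈ S ∧ t ∈ S ∧ ¬ R s t ∧ ¬ R t s) ∨
  (∃ s t₁ t₂ : List α, s.length = k ∧ t₁.length = k ∧ t₂.length = k ∧
    R s t₁ ∧ R s t₂ ∧
    ¬ (¬ R t₁ s ↔ t₁ ∈ F (upClosure S R s)) ∧
    (¬ R t₂ s ∨ t₂ ∉ F (upClosure S R s)))

/-- The answers of the equivalence oracle to a candidate automaton `c`. The candidate is accepted
(`none`) if the first-order criterion refutes it at no length. Otherwise a length at which it is
refuted is chosen, and a counterexample of that length is found by enumeration: a word on which the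
answer of the membership oracle differs from that of `c`. -/
def IsEquivalenceAnswer (F : Language α → Language α) (S : Language α)
    (c : AutomatonCode (α × α)) : Option (List (α × α)) → Prop
  | none => ∀ k : ℕ, ¬ Refutes F S (relOf (AutomatonCode.lang c)) k
  | some w => Refutes F S (relOf (AutomatonCode.lang c)) w.length ∧
      ∃ b : Bool, IsMembershipAnswer F S w b ∧ ¬ (w ∈ AutomatonCode.lang c ↔ b = true)

end Oracles

section LStar

variable {Γ : Type u}

/-- The row of the word `u` in the observation table with suffixes `E`. -/
def row (mem : List Γ → Bool) (E : List (List Γ)) (u : List Γ) : List Bool :=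
  E.map fun e => mem (u ++ e)

/-- The observation table with prefixes `P` and suffixes `E` is closed. -/
def IsClosedTable (mem : List Γ → Bool) (P E : List (List Γ)) : Prop :=
  ∀ s ∈ P, ∀ a : Γ, ∃ p ∈ P, row mem E p = row mem E (s ++ [a])

/-- The observation table with prefixes `P` and suffixes `E` is consistent. -/
def IsConsistentTable (mem : List Γ → Bool) (P E : List (List Γ)) : Prop :=
  ∀ s₁ ∈ P, ∀ s₂ ∈ P, row mem E s₁ = row mem E s₂ →
    ∀ a : Γ, row mem E (s₁ ++ [a]) = row mem E (s₂ ++ [a])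

/-- The state of the conjectured automaton that stands for the row of `u`: the position of the
first prefix with the same row. -/
def rowIndex (mem : List Γ → Bool) (P E : List (List Γ)) (u : List Γ) : ℕ :=
  P.findIdx fun p => row mem E p == row mem E u

/-- The automaton conjectured from an observation table: its states are the rows of the prefixes,
the initial state is the row of the empty word, the accepting states are the rows of the prefixes
`s` with `mem s`, and the row of `s` goes to the row of `s ++ [a]` under the letter `a`. -/
noncomputable def conjecture [Fintype Γ] (mem : List Γ → Bool) (P E : List (List Γ)) :
    AutomatonCode Γ :=
  ([rowIndex mem P E []],
   P.flatMap fun s => (Finset.univ : Finset Γ).toList.map fun a =>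
     (rowIndex mem P E s, a, rowIndex mem P E (s ++ [a])),
   (P.filter fun s => mem s).map fun s => rowIndex mem P E s)

/-- The configurations of the learner: an observation table, given by its prefixes and its suffixes
(its entries are the answers to membership queries), or a final output. -/
inductive LearnerState (Γ : Type u) : Type u
  | table (P E : List (List Γ)) : LearnerState Γ
  | output (c : AutomatonCode Γ) : LearnerState Γ

/-- The initial observation table, with the empty word as only prefix and only suffix. -/
def LearnerState.init : LearnerState Γ :=
  .table [[]] [[]]

/-- The steps of Angluin's `L*` algorithm with membership oracle `mem` and equivalence oracle
`equiv` (`equiv c r` says that `r` is a possible answer to the conjecture `c`). Whatever the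
algorithm leaves open is left open here. -/
inductive LStarStep [Fintype Γ] (mem : List Γ → Bool)
    (equiv : AutomatonCode Γ → Option (List Γ) → Prop) : LearnerState Γ → LearnerState Γ → Prop
  | inconsistent (P E : List (List Γ)) (s₁ s₂ : List Γ) (a : Γ) (e : List Γ) :
      s₁ ∈ P → s₂ ∈ P → e ∈ E → row mem E s₁ = row mem E s₂ →
      mem (s₁ ++ a :: e) ≠ mem (s₂ ++ a :: e) →
      LStarStep mem equiv (.table P E) (.table P ((a :: e) :: E))
  | unclosed (P E : List (List Γ)) (s : List Γ) (a : Γ) :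
      s ∈ P → (∀ p ∈ P, row mem E p ≠ row mem E (s ++ [a])) →
      LStarStep mem equiv (.table P E) (.table ((s ++ [a]) :: P) E)
  | counterexample (P E : List (List Γ)) (w : List Γ) :
      IsClosedTable mem P E → IsConsistentTable mem P E →
      equiv (conjecture mem P E) (some w) →
      LStarStep mem equiv (.table P E) (.table (w.inits ++ P) E)
  | accept (P E : List (List Γ)) :
      IsClosedTable mem P E → IsConsistentTable mem P E →
      equiv (conjecture mem P E) none →
      LStarStep mem equiv (.table P E) (.output (conjecture mem P E))

/-- Some run of `L*` outputs the automaton `c`. -/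
def MayReturn [Fintype Γ] (mem : List Γ → Bool)
    (equiv : AutomatonCode Γ → Option (List Γ) → Prop) (c : AutomatonCode Γ) : Prop :=
  Relation.ReflTransGen (LStarStep mem equiv) LearnerState.init (.output c)

/-- Every run of `L*` is finite and, when it cannot be continued, has output an automaton that
recognizes `L`. -/
def TerminatesReturning [Fintype Γ] (mem : List Γ → Bool)
    (equiv : AutomatonCode Γ → Option (List Γ) → Prop) (L : Language Γ) : Prop :=
  (¬ ∃ r : ℕ → LearnerState Γ, r 0 = LearnerState.init ∧
    ∀ n, LStarStep mem equiv (r n) (r (n + 1))) ∧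
  ∀ x, Relation.ReflTransGen (LStarStep mem equiv) LearnerState.init x →
    (∀ y, ¬ LStarStep mem equiv x y) →
      ∃ c, x = .output c ∧ AutomatonCode.lang c = L

end LStar

end DisappearanceLearning

open DisappearanceLearning

/-! Since `F` commutes with restriction to a length, everything can be checked on the finite sets `Σ
^ l`. There the iterates decrease and become stationary within `|Σ| ^ l` steps, so `≼` is decidable
and the membership loop computes it (`isMembershipAnswer_iff`).

The refutation criterion characterizes `≼` length by length. For `≼`, the upward closure of `s` is
the last stage containing `s`, or the stationary stage if `s` never leaves; applying `F` removes
exactly the class of `s`, or nothing. Conversely, an unrefuted `R` is a total preorder on `S ∩ Σ ^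
l`. Starting from all of `S ∩ Σ ^ l`, each nonempty stage is the upward closure of a least element,
and `F` either removes its class or fixes the stage. Hence the stages peel off classes from the
bottom, which forces `R` to be `≼` (`not_refutes_of_forall_iff`, `iff_disappears_of_not_refutes`).

Uniform regularity supplies an automaton for the images `F (↑s)`, so refutation becomes a property
of a word of triples that depends only on three automata. A pumping argument bounds the shortest
refuting word (`exists_length_lt_of_acceptance_invariant`). Acceptance is therefore decidable, and
after a refutation an unbounded search for a counterexample must succeed.

For termination, the number of distinct rows is bounded by the number of left quotients, finite in
the regular case. A counterexample need not add a row at once, but two consecutive steps followed by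
a third always do (`LStarStep.rowCount_lt`). -/

namespace DisappearanceLearning

/-! ### Iterates of `F` at a fixed length -/

section Iterates

variable {α : Type u} {F : Language α → Language α} {S : Language α}

theorem mem_restrictLength {X : Language α} {l : ℕ} {w : List α} :
    w ∈ restrictLength X l ↔ w ∈ X ∧ w.length = l := Iff.rfl

theorem stateSpace_succ (k : ℕ) : stateSpace F S (k + 1) = F (stateSpace F S k) :=
  Function.iterate_succ_apply' F k S

theorem stateSpace_antitone (hF : ∀ X : Language α, F X ≤ X) : Antitone (stateSpace F S) :=
  antitone_nat_of_succ_le fun k => by rw [stateSpace_succ]; exact hF _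

theorem stateSpace_restrictLength (hlen : IndependentlyLengthPreserving F) (l k : ℕ) :
    stateSpace F (restrictLength S l) k = restrictLength (stateSpace F S k) l := by
  induction k with
  | zero => rfl
  | succ k ih => rw [stateSpace_succ, ih, stateSpace_succ, hlen]

theorem mem_stateSpace_restrictLength (hlen : IndependentlyLengthPreserving F) {k : ℕ}
    {l : ℕ} {w : List α} (hw : w.length = l) :
    w ∈ stateSpace F (restrictLength S l) k ↔ w ∈ stateSpace F S k := by
  rw [stateSpace_restrictLength hlen, mem_restrictLength]
  simp [hw]

theorem stateSpace_eq_of_stationary {k : ℕ} (h : stateSpace F S k = stateSpace F S (k + 1))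
    {j : ℕ} (hj : k ≤ j) : stateSpace F S j = stateSpace F S k := by
  induction j, hj using Nat.le_induction with
  | base => rfl
  | succ j _ ih => rw [stateSpace_succ, ih, ← stateSpace_succ (F := F), ← h]

variable [Fintype α]

theorem ncard_setOf_length_eq (l : ℕ) :
    {w : List α | w.length = l}.ncard = Fintype.card α ^ l := by
  rw [← card_vector, ← Nat.card_coe_set_eq, ← Nat.card_eq_fintype_card]
  rfl

/-- Each step that is not stationary removes at least one of the `|Σ| ^ l` words of length `l`. -/
theorem exists_stationary (hF : ∀ X : Language α, F X ≤ X) (l : ℕ) :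
    ∃ k ≤ Fintype.card α ^ l, stateSpace F (restrictLength S l) k =
      stateSpace F (restrictLength S l) (k + 1) := by
  by_contra! hne
  have hfin : {w : List α | w.length = l}.Finite := List.finite_length_eq α l
  have hsub : ∀ k, ∀ w ∈ stateSpace F (restrictLength S l) k,
      w ∈ {w : List α | w.length = l} := fun k w hw =>
    (stateSpace_antitone hF (Nat.zero_le k) hw).2
  -- The range reaches one past `|Σ| ^ l`: at that last index the inequality is impossible.
  have key : ∀ k ≤ Fintype.card α ^ l + 1,
      Set.ncard (stateSpace F (restrictLength S l) k : Set (List α)) + k ≤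
        Fintype.card α ^ l := by
    intro k
    induction k with
    | zero =>
      intro _
      rw [← ncard_setOf_length_eq]
      exact Set.ncard_le_ncard (hsub 0) hfin
    | succ k ih =>
      intro hk
      have h1 := ih (by omega)
      have h2 : Set.ncard (stateSpace F (restrictLength S l) (k + 1) : Set (List α)) <
          Set.ncard (stateSpace F (restrictLength S l) k : Set (List α)) :=
        Set.ncard_lt_ncard
          (lt_of_le_of_ne (stateSpace_antitone hF (Nat.le_succ k))
            (hne k (by omega)).symm) (hfin.subset (hsub k))
      omega
  have := key _ le_rfl
  omega

/-- Stages after the stationary one repeat it. The bound depends only on the length, which makes `≼`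
decidable by a bounded loop. -/
theorem disappears_iff_forall_le (hF : ∀ X : Language α, F X ≤ X)
    (hlen : IndependentlyLengthPreserving F) {l : ℕ} {s t : List α} (hs : s.length = l)
    (ht : t.length = l) :
    Disappears F S s t ↔ s ∈ S ∧ t ∈ S ∧
      ∀ k ≤ Fintype.card α ^ l, s ∈ stateSpace F S k → t ∈ stateSpace F S k := by
  refine and_congr_right fun _ => and_congr_right fun _ => ⟨fun h k _ => h k, fun h j => ?_⟩
  obtain ⟨k, hk, hst⟩ := exists_stationary (S := S) hF l
  rcases le_total j k with hj | hj
  · exact h j (hj.trans hk)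
  · have := h k hk
    rw [← mem_stateSpace_restrictLength hlen hs, ← mem_stateSpace_restrictLength hlen ht] at this ⊢
    rwa [stateSpace_eq_of_stationary hst hj]

end Iterates

/-! ### Correctness of the membership oracle -/

section MembershipOracle

variable {α : Type u} {F : Language α → Language α} {S : Language α}

theorem zip_injective_of_length {s t s' t' : List α} (h : s.length = t.length)
    (h' : s'.length = t'.length) (he : s.zip t = s'.zip t') : s = s' ∧ t = t' := by
  have h1 := congrArg (List.map Prod.fst) he
  have h2 := congrArg (List.map Prod.snd) he
  rw [List.map_fst_zip h.le, List.map_fst_zip h'.le] at h1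
  rw [List.map_snd_zip h.ge, List.map_snd_zip h'.ge] at h2
  exact ⟨h1, h2⟩

theorem zip_map_fst_snd (w : List (α × α)) : (w.map Prod.fst).zip (w.map Prod.snd) = w := by
  induction w with
  | nil => rfl
  | cons a w ih => simp [ih]

theorem zip_mem_disappearanceLanguage {s t : List α} (h : s.length = t.length) :
    s.zip t ∈ disappearanceLanguage F S ↔ Disappears F S s t := by
  constructor
  · rintro ⟨s', t', h', he, hd⟩
    obtain ⟨rfl, rfl⟩ := zip_injective_of_length h h' he
    exact hd
  · exact fun hd => ⟨s, t, h, rfl, hd⟩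

theorem mem_disappearanceLanguage {w : List (α × α)} :
    w ∈ disappearanceLanguage F S ↔ Disappears F S (w.map Prod.fst) (w.map Prod.snd) := by
  conv_lhs => rw [← zip_map_fst_snd w]
  exact zip_mem_disappearanceLanguage (by simp)

variable [Fintype α]

/-- Before the stopping stage both words are present, so the implication defining `≼` holds there.
From the stopping stage on, either `s` stays absent or the iterates no longer change, unless `t`
alone is missing, and then the implication fails at that very stage. -/
theorem isMembershipAnswer_iff (hF : ∀ X : Language α, F X ≤ X)
    (hlen : IndependentlyLengthPreserving F) {w : List (α × α)} {b : Bool} :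
    IsMembershipAnswer F S w b ↔ (b = true ↔ w ∈ disappearanceLanguage F S) := by
  classical
  have key : ∀ (s t : List α) (k : ℕ), s.length = t.length → MembershipLoopStops F S s t k →
      (∀ j < k, ¬ MembershipLoopStops F S s t j) →
      ((s ∈ S ∧ t ∈ S ∧ (s ∈ stateSpace F (restrictLength S s.length) k →
        t ∈ stateSpace F (restrictLength S s.length) k)) ↔ Disappears F S s t) := by
    intro s t k hst hk hmin
    refine and_congr_right fun _ => and_congr_right fun _ => ⟨fun h j => ?_, fun h => ?_⟩
    · rw [← mem_stateSpace_restrictLength hlen (rfl : s.length = _),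
        ← mem_stateSpace_restrictLength hlen hst.symm]
      rcases lt_or_ge j k with hj | hj
      · have := hmin j hj
        simp only [MembershipLoopStops, not_or, not_not] at this
        exact fun _ => this.2.1
      · intro hs
        have hs' := stateSpace_antitone hF hj hs
        rcases hk with hk | hk | hk
        · exact absurd hs' hk
        · exact absurd (h hs') hk
        · rw [stateSpace_eq_of_stationary hk hj]
          exact h hs'
    · have := h k
      rwa [← mem_stateSpace_restrictLength hlen (rfl : s.length = _),
        ← mem_stateSpace_restrictLength hlen hst.symm] at this
  constructor
  · rintro ⟨s, t, k, hst, rfl, hk, hmin, hb⟩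
    rw [hb, zip_mem_disappearanceLanguage hst, key s t k hst hk hmin]
  · intro hb
    have hst : (w.map Prod.fst).length = (w.map Prod.snd).length := by simp
    have hex : ∃ k, MembershipLoopStops F S (w.map Prod.fst) (w.map Prod.snd) k := by
      obtain ⟨k, -, hk⟩ := exists_stationary (S := S) hF (w.map Prod.fst).length
      exact ⟨k, .inr (.inr hk)⟩
    have hmin : ∀ j < Nat.find hex, ¬ MembershipLoopStops F S _ _ j := fun j => Nat.find_min hex
    refine ⟨_, _, Nat.find hex, hst, (zip_map_fst_snd w).symm, Nat.find_spec hex, hmin, ?_⟩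
    rw [hb, key _ _ _ hst (Nat.find_spec hex) hmin, mem_disappearanceLanguage]

end MembershipOracle

/-! ### The refutation criterion characterizes the disappearance relation -/

section Refutation

variable {α : Type u} {F : Language α → Language α} {S : Language α}

/-- Agreement is required at the single length `l` only; this is what places a counterexample at the
very length where a candidate is refuted. -/
theorem not_refutes_of_forall_iff [Fintype α] (hF : ∀ X : Language α, F X ≤ X)
    (hlen : IndependentlyLengthPreserving F) {R : List α → List α → Prop} {l : ℕ}
    (hRlen : ∀ s t, R s t → s.length = t.length)
    (hR : ∀ s t : List α, s.length = l → t.length = l → (R s t ↔ Disappears F S s t)) :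
    ¬ Refutes F S R l := by
  have anti : Antitone (stateSpace F S) := stateSpace_antitone hF
  rintro (⟨s, t, hs, ht, hst, hn⟩ | ⟨s, hs, hsS, hn⟩ | ⟨s₁, s₂, s₃, h₁, h₂, h₃, h₁₂, h₂₃, hn⟩ |
    ⟨s, t, hs, ht, hsS, htS, hn, hn'⟩ | ⟨s, t₁, t₂, hs, ht₁, ht₂, h₁, h₂, hn, hn'⟩)
  · rw [hR s t hs ht] at hst
    exact hn ⟨hst.1, hst.2.1⟩
  · exact hn ((hR s s hs hs).2 ⟨hsS, hsS, fun _ h => h⟩)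
  · rw [hR _ _ h₁ h₂] at h₁₂
    rw [hR _ _ h₂ h₃] at h₂₃
    exact hn ((hR _ _ h₁ h₃).2 ⟨h₁₂.1, h₂₃.2.1, fun k h => h₂₃.2.2 k (h₁₂.2.2 k h)⟩)
  · rw [hR _ _ hs ht] at hn
    rw [hR _ _ ht hs] at hn'
    simp only [Disappears, not_and, not_forall] at hn hn'
    obtain ⟨i, hi, hi'⟩ := hn hsS htS
    obtain ⟨j, hj, hj'⟩ := hn' htS hsS
    rcases le_total i j with h | h
    · exact hi' (anti h hj)
    · exact hj' (anti h hi)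
  · have hR₁ := (hR _ _ hs ht₁).1 h₁
    have hR₂ := (hR _ _ hs ht₂).1 h₂
    by_cases hall : ∀ k, s ∈ stateSpace F S k
    · obtain ⟨k, -, hk⟩ := exists_stationary (S := S) hF l
      have hup : upClosure S R s = stateSpace F (restrictLength S l) k := by
        ext u
        constructor
        · rintro ⟨-, hu⟩
          have hul : u.length = l := (hRlen _ _ hu).symm.trans hs
          rw [mem_stateSpace_restrictLength hlen hul]
          exact ((hR _ _ hs hul).1 hu).2.2 k (hall k)
        · intro hu
          have hu0 := stateSpace_antitone hF (Nat.zero_le k) hu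
          refine ⟨hu0.1, (hR _ _ hs hu0.2).2 ⟨hR₁.1, hu0.1, fun j _ => ?_⟩⟩
          rw [← mem_stateSpace_restrictLength hlen hu0.2]
          rcases le_total j k with hj | hj
          · exact stateSpace_antitone hF hj hu
          · rwa [stateSpace_eq_of_stationary hk hj]
      rcases hn' with hn' | hn'
      · exact hn' ((hR _ _ ht₂ hs).2 ⟨hR₂.2.1, hR₂.1, fun k _ => hall k⟩)
      · rw [hup, ← stateSpace_succ (F := F), ← hk, ← hup] at hn'
        exact hn' ⟨hR₂.2.1, h₂⟩
    · classical
      push Not at hall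
      -- The first stage missing `s` is not stage 0, because `s ∈ S`. So `j` is the last stage
      -- containing `s`, `↑s` is stage `j`, and `F (↑s)` is the set of words strictly above `s`.
      obtain ⟨j, hj⟩ : ∃ j, Nat.find hall = j + 1 :=
        Nat.exists_eq_succ_of_ne_zero fun h0 => by
          have := Nat.find_spec hall
          rw [h0] at this
          exact this hR₁.1
      have hj1 : s ∉ stateSpace F S (j + 1) := hj ▸ Nat.find_spec hall
      have hj0 : s ∈ stateSpace F S j := by
        by_contra h
        have := Nat.find_min' hall h
        omega
      have hup : upClosure S R s = restrictLength (stateSpace F S j) l := by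
        ext u
        constructor
        · rintro ⟨-, hu⟩
          have hul : u.length = l := (hRlen _ _ hu).symm.trans hs
          exact ⟨((hR _ _ hs hul).1 hu).2.2 j hj0, hul⟩
        · rintro ⟨hu, hul⟩
          have huS : u ∈ S := anti (Nat.zero_le j) hu
          refine ⟨huS, (hR _ _ hs hul).2 ⟨hR₁.1, huS, fun i hi => ?_⟩⟩
          have hij : i ≤ j := by
            by_contra! h
            exact hj1 (anti h hi)
          exact anti hij hu
      apply hn
      rw [hup, hlen, ← stateSpace_succ (F := F), mem_restrictLength, hR _ _ ht₁ hs]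
      constructor
      · intro h
        refine ⟨?_, ht₁⟩
        by_contra ht
        refine h ⟨hR₁.2.1, hR₁.1, fun i hi => ?_⟩
        have hij : i ≤ j := by
          by_contra! h
          exact ht (anti h hi)
        exact anti hij hj0
      · rintro ⟨ht, -⟩ h
        exact hj1 (h.2.2 _ ht)

theorem exists_isLeast_of_total [Finite α] {R : List α → List α → Prop} {l : ℕ}
    {X : Set (List α)} (hX : ∀ u ∈ X, u.length = l) (hne : X.Nonempty)
    (hrefl : ∀ u ∈ X, R u u) (htrans : ∀ u ∈ X, ∀ v ∈ X, ∀ w ∈ X, R u v → R v w → R u w)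
    (htotal : ∀ u ∈ X, ∀ v ∈ X, R u v ∨ R v u) :
    ∃ x ∈ X, ∀ u ∈ X, R x u := by
  have hfin : X.Finite := (List.finite_length_eq α l).subset hX
  clear hX
  induction X, hfin using Set.Finite.induction_on with
  | empty => exact absurd hne Set.not_nonempty_empty
  | @insert a Y ha hY ih =>
    rcases Y.eq_empty_or_nonempty with rfl | hYne
    · refine ⟨a, by simp, ?_⟩
      intro u hu
      have hua : u = a := by simpa using hu
      subst hua
      exact hrefl u hu
    · obtain ⟨x, hx, hmin⟩ := ih hYne (fun u hu => hrefl u (.inr hu))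
        (fun u hu v hv w hw => htrans u (.inr hu) v (.inr hv) w (.inr hw))
        (fun u hu v hv => htotal u (.inr hu) v (.inr hv))
      rcases htotal a (.inl rfl) x (.inr hx) with h | h
      · refine ⟨a, .inl rfl, fun u hu => ?_⟩
        rcases hu with rfl | hu
        · exact hrefl _ (.inl rfl)
        · exact htrans a (.inl rfl) x (.inr hx) u (.inr hu) h (hmin u hu)
      · refine ⟨x, .inr hx, fun u hu => ?_⟩
        rcases hu with rfl | hu
        · exact h
        · exact hmin u hu

/-- Every stage is upward closed for `R`, which gives `R s t → s ≼ t`. If `s ≼ t` but `R s t`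
failed, then `t` would lie strictly below `s`. As long as `t` is present, the stage would lose
exactly its least class, which does not contain `s`; thus `s` and hence `t` would survive each step,
and a nonempty class would be lost at every stage, against stationarity. -/
theorem iff_disappears_of_not_refutes [Fintype α] (hF : ∀ X : Language α, F X ≤ X)
    (hlen : IndependentlyLengthPreserving F) {R : List α → List α → Prop} {l : ℕ}
    (hRlen : ∀ s t, R s t → s.length = t.length) (hnot : ¬ Refutes F S R l)
    {s t : List α} (hs : s.length = l) (ht : t.length = l) :
    R s t ↔ Disappears F S s t := by
  simp only [Refutes, not_or] at hnot
  obtain ⟨c1, c2, c3, c4, c5⟩ := hnot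
  have sub : ∀ s t : List α, s.length = l → t.length = l → R s t → s ∈ S ∧ t ∈ S := by
    intro s t hs ht h
    by_contra hn
    exact c1 ⟨s, t, hs, ht, h, hn⟩
  have rfl' : ∀ s : List α, s.length = l → s ∈ S → R s s := by
    intro s hs h
    by_contra hn
    exact c2 ⟨s, hs, h, hn⟩
  have trans' : ∀ s₁ s₂ s₃ : List α, s₁.length = l → s₂.length = l → s₃.length = l →
      R s₁ s₂ → R s₂ s₃ → R s₁ s₃ := by
    intro s₁ s₂ s₃ h₁ h₂ h₃ h h'
    by_contra hn
    exact c3 ⟨s₁, s₂, s₃, h₁, h₂, h₃, h, h', hn⟩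
  have total' : ∀ s t : List α, s.length = l → t.length = l → s ∈ S → t ∈ S →
      R s t ∨ R t s := by
    intro s t hs ht hsS htS
    by_contra! hn
    exact c4 ⟨s, t, hs, ht, hsS, htS, hn.1, hn.2⟩
  -- Condition 5 uses two witnesses `t₁`, `t₂`, so its negation is a disjunction of two universal
  -- statements: `F` removes exactly the class of `x` from `↑x`, or `↑x` is a single class fixed by
  -- `F`.
  have image : ∀ x : List α, x.length = l →
      (∀ u, u.length = l → R x u → (¬ R u x ↔ u ∈ F (upClosure S R x))) ∨
      (∀ u, u.length = l → R x u → R u x ∧ u ∈ F (upClosure S R x)) := by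
    intro x hx
    by_contra! hn
    obtain ⟨⟨u, hu, hxu, h⟩, v, hv, hxv, h'⟩ := hn
    refine c5 ⟨x, u, v, hx, hu, hv, hxu, hxv, ?_, ?_⟩
    · rcases h with h | h <;> tauto
    · tauto
  have mem_up : ∀ x u : List α, x.length = l → (u ∈ upClosure S R x ↔ R x u) := by
    intro x u hx
    exact ⟨fun h => h.2, fun h => ⟨(sub x u hx ((hRlen _ _ h).symm.trans hx) h).2, h⟩⟩
  set T := stateSpace F (restrictLength S l) with hT
  have anti : Antitone T := stateSpace_antitone hF
  have Tlen : ∀ k, ∀ u ∈ T k, u.length = l := fun k u hu => (anti (Nat.zero_le k) hu).2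
  have TS : ∀ k, ∀ u ∈ T k, u ∈ S := fun k u hu => (anti (Nat.zero_le k) hu).1
  have up_of_closed : ∀ k, (∀ u ∈ T k, ∀ v, R u v → v ∈ T k) → (∃ u, u ∈ T k) →
      ∃ x, x.length = l ∧ x ∈ S ∧ T k = upClosure S R x := by
    intro k hcl hne
    obtain ⟨x, hx, hmin⟩ := exists_isLeast_of_total (R := R) (X := T k) (Tlen k) hne
      (fun u hu => rfl' u (Tlen k u hu) (TS k u hu))
      (fun u hu v hv w hw => trans' u v w (Tlen k u hu) (Tlen k v hv) (Tlen k w hw))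
      (fun u hu v hv => total' u v (Tlen k u hu) (Tlen k v hv) (TS k u hu) (TS k v hv))
    refine ⟨x, Tlen k x hx, TS k x hx, ?_⟩
    ext u
    rw [mem_up x u (Tlen k x hx)]
    exact ⟨hmin u, hcl x hx u⟩
  have closed : ∀ k, ∀ u ∈ T k, ∀ v, R u v → v ∈ T k := by
    intro k
    induction k with
    | zero =>
      intro u hu v huv
      have hv : v.length = l := (hRlen _ _ huv).symm.trans hu.2
      exact ⟨(sub u v hu.2 hv huv).2, hv⟩
    | succ k ih =>
      intro u hu v huv
      have huk := anti (Nat.le_succ k) hu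
      obtain ⟨x, hx, -, hTx⟩ := up_of_closed k ih ⟨u, huk⟩
      have hvk := ih u huk v huv
      have hul := Tlen k u huk
      have hvl := Tlen k v hvk
      have hxu : R x u := (mem_up x u hx).1 (hTx ▸ huk)
      have hxv : R x v := (mem_up x v hx).1 (hTx ▸ hvk)
      have hsucc : T (k + 1) = F (upClosure S R x) := by rw [← hTx]; exact stateSpace_succ k
      rw [hsucc] at hu ⊢
      rcases image x hx with h | h
      · rw [← h u hul hxu] at hu
        rw [← h v hvl hxv]
        exact fun hvx => hu (trans' u v x hul hvl hx huv hvx)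
      · exact (h v hvl hxv).2
  constructor
  · intro hst
    obtain ⟨hsS, htS⟩ := sub s t hs ht hst
    refine ⟨hsS, htS, fun k hk => ?_⟩
    rw [← mem_stateSpace_restrictLength hlen hs] at hk
    rw [← mem_stateSpace_restrictLength hlen ht]
    exact closed k s hk t hst
  · rintro ⟨hsS, htS, hd⟩
    by_contra hst
    have hts : R t s := (total' s t hs ht hsS htS).resolve_left hst
    have step : ∀ k, t ∈ T k → ∃ x, x.length = l ∧ x ∈ S ∧ T k = upClosure S R x ∧
        ∀ u ∈ T k, ¬ R u x ↔ u ∈ T (k + 1) := by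
      intro k htk
      obtain ⟨x, hx, hxS, hTx⟩ := up_of_closed k (closed k) ⟨t, htk⟩
      refine ⟨x, hx, hxS, hTx, fun u hu => ?_⟩
      have hsucc : T (k + 1) = F (upClosure S R x) := by rw [← hTx]; exact stateSpace_succ k
      have hxt : R x t := (mem_up x t hx).1 (hTx ▸ htk)
      have hxu : R x u := (mem_up x u hx).1 (hTx ▸ hu)
      rcases image x hx with h | h
      · rw [hsucc]
        exact h u (Tlen k u hu) hxu
      -- The single-class alternative is excluded: it would give `R s x` and `R x t`, hence `R s t`.
      · have hxs : R x s := trans' x t s hx ht hs hxt hts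
        exact absurd (trans' s x t hs hx ht (h s hs hxs).1 hxt) hst
    have all : ∀ k, t ∈ T k := by
      intro k
      induction k with
      | zero => exact ⟨htS, ht⟩
      | succ k ih =>
        obtain ⟨x, hx, hxS, hTx, hst'⟩ := step k ih
        have hxt : R x t := (mem_up x t hx).1 (hTx ▸ ih)
        have hsk : s ∈ T k := closed k t ih s hts
        have hsk1 : s ∈ T (k + 1) :=
          (hst' s hsk).1 fun hsx => hst (trans' s x t hs hx ht hsx hxt)
        have := hd (k + 1) ((mem_stateSpace_restrictLength hlen hs).1 hsk1)
        exact (mem_stateSpace_restrictLength hlen ht).2 this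
    -- At a stationary stage the least element `x` would have to be removed, yet the next stage is
    -- the same.
    obtain ⟨k, -, hk⟩ := exists_stationary (S := S) hF l
    obtain ⟨x, hx, hxS, hTx, hst'⟩ := step k (all k)
    have hxk : x ∈ T k := by rw [hTx, mem_up x x hx]; exact rfl' x hx hxS
    exact (hst' x hxk).2 (hk ▸ hxk : x ∈ stateSpace F (restrictLength S l) (k + 1)) (rfl' x hx hxS)

theorem relOf_length {L : Language (α × α)} {s t : List α} (h : relOf L s t) :
    s.length = t.length := h.1

theorem relOf_iff_zip_mem {L : Language (α × α)} {s t : List α} (h : s.length = t.length) :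
    relOf L s t ↔ s.zip t ∈ L := and_iff_right h

/-- A candidate that is refuted at no length is the disappearance language. -/
theorem eq_disappearanceLanguage_of_not_refutes [Fintype α] (hF : ∀ X : Language α, F X ≤ X)
    (hlen : IndependentlyLengthPreserving F) {L : Language (α × α)}
    (h : ∀ k, ¬ Refutes F S (relOf L) k) : L = disappearanceLanguage F S := by
  ext w
  rw [mem_disappearanceLanguage, ← iff_disappears_of_not_refutes hF hlen
    (fun _ _ => relOf_length) (h w.length) (by simp) (by simp), relOf_iff_zip_mem (by simp),
    zip_map_fst_snd]

/-- A candidate refuted at length `k` differs from the disappearance language at length `k`. -/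
theorem exists_mem_not_iff_of_refutes [Fintype α] (hF : ∀ X : Language α, F X ≤ X)
    (hlen : IndependentlyLengthPreserving F) {L : Language (α × α)} {k : ℕ}
    (h : Refutes F S (relOf L) k) :
    ∃ w : List (α × α), w.length = k ∧ ¬ (w ∈ L ↔ w ∈ disappearanceLanguage F S) := by
  by_contra! hn
  refine not_refutes_of_forall_iff hF hlen (fun _ _ => relOf_length) (fun s t hs ht => ?_) h
  have hst : s.length = t.length := hs.trans ht.symm
  rw [relOf_iff_zip_mem hst, hn _ (by simp [hs, ht]), zip_mem_disappearanceLanguage hst]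

end Refutation

/-! ### Coded automata and regular languages -/

section CodedAutomata

variable {Γ : Type u}

/-- A finite set of states containing all reachable states of the automaton of a code. -/
def AutomatonCode.support (c : AutomatonCode Γ) : Finset ℕ :=
  (c.1 ++ c.2.1.map fun t => t.2.2).toFinset

theorem AutomatonCode.eval_subset_support (c : AutomatonCode Γ) (w : List Γ) :
    c.toNFA.eval w ⊆ c.support := by
  intro q hq
  induction w using List.reverseRecOn with
  | nil =>
    have : q ∈ c.1 := hq
    simp [AutomatonCode.support, this]
  | append_singleton w a _ =>
    rw [NFA.eval_append_singleton, NFA.mem_stepSet] at hq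
    obtain ⟨p, -, hp⟩ := hq
    have hp' : (p, a, q) ∈ c.2.1 := hp
    simp only [AutomatonCode.support, List.coe_toFinset, List.mem_append, List.mem_map,
      Set.mem_ofPred_eq]
    exact .inr ⟨_, hp', rfl⟩

theorem AutomatonCode.mem_lang {c : AutomatonCode Γ} {w : List Γ} :
    w ∈ c.lang ↔ ∃ q ∈ c.2.2, q ∈ c.toNFA.eval w := Iff.rfl

/-- The language of a code is regular. -/
theorem AutomatonCode.isRegular_lang (c : AutomatonCode Γ) : c.lang.IsRegular := by
  refine Language.IsRegular.of_finite_range_leftQuotient ?_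
  have hfin : {A : Set ℕ | A ⊆ c.support}.Finite := c.support.finite_toSet.finite_subsets
  -- A left quotient is determined by the set of states reached, one of finitely many subsets of
  -- `c.support`.
  refine (hfin.image fun A => c.toNFA.acceptsFrom A).subset ?_
  rintro _ ⟨u, rfl⟩
  refine ⟨c.toNFA.eval u, c.eval_subset_support u, ?_⟩
  ext v
  rw [Language.mem_leftQuotient, AutomatonCode.lang, NFA.accepts]
  exact (NFA.append_mem_acceptsFrom (M := c.toNFA)).symm

/-- The code of a deterministic automaton with finitely many states. -/
theorem exists_code_of_isRegular [Finite Γ] {L : Language Γ} (hL : L.IsRegular) :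
    ∃ c : AutomatonCode Γ, c.lang = L := by
  classical
  obtain ⟨σ, _, M, rfl⟩ := hL
  have := Fintype.ofFinite Γ
  let e : σ → ℕ := fun q => Fintype.equivFin σ q
  have he : Function.Injective e := Fin.val_injective.comp (Fintype.equivFin σ).injective
  let c : AutomatonCode Γ :=
    ([e M.start],
     (Finset.univ : Finset (σ × Γ)).toList.map fun x => (e x.1, x.2, e (M.step x.1 x.2)),
     ((Finset.univ : Finset σ).filter (· ∈ M.accept)).toList.map e)
  have heval : ∀ w, c.toNFA.eval w = {e (M.eval w)} := by
    intro w
    induction w using List.reverseRecOn with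
    | nil => ext q; simp [AutomatonCode.toNFA, c]
    | append_singleton w a ih =>
      rw [NFA.eval_append_singleton, ih, NFA.stepSet_singleton, DFA.eval_append_singleton]
      ext q
      simp only [AutomatonCode.toNFA, c, List.mem_map, Finset.mem_toList, Finset.mem_univ,
        true_and, Set.mem_ofPred_eq, Set.mem_singleton_iff, Prod.exists, Prod.mk.injEq]
      constructor
      · rintro ⟨p, b, hp, rfl, rfl⟩
        rw [he hp]
      · rintro rfl
        exact ⟨_, _, rfl, rfl, rfl⟩
  refine ⟨c, ?_⟩
  ext w
  rw [AutomatonCode.mem_lang, heval, DFA.mem_accepts]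
  simp only [c, List.mem_map, Finset.mem_toList, Finset.mem_filter, Finset.mem_univ, true_and,
    Set.mem_singleton_iff]
  constructor
  · rintro ⟨_, ⟨q, hq, rfl⟩, hqe⟩
    rwa [← he hqe]
  · exact fun h => ⟨_, ⟨_, h, rfl⟩, rfl⟩

end CodedAutomata

/-! ### Rows of observation tables -/

section ObservationTables

variable {Γ : Type u} {mem : List Γ → Bool}

theorem row_cons (E : List (List Γ)) (e u : List Γ) :
    row mem (e :: E) u = mem (u ++ e) :: row mem E u := rfl

theorem mem_eq_of_row_eq {E : List (List Γ)} {u v e : List Γ} (h : row mem E u = row mem E v)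
    (he : e ∈ E) : mem (u ++ e) = mem (v ++ e) :=
  List.map_inj_left.1 h e he

/-- The distinct rows of the prefixes of a table. -/
def rowSet (mem : List Γ → Bool) (P E : List (List Γ)) : Finset (List Bool) :=
  (P.map (row mem E)).toFinset

theorem mem_rowSet {P E : List (List Γ)} {x : List Bool} :
    x ∈ rowSet mem P E ↔ ∃ p ∈ P, row mem E p = x := by
  simp [rowSet]

/-- Dropping the new first entry maps the new rows onto the old ones, and this map is not injective:
the rows of `s₁` and `s₂` are separated only by the new suffix. -/
theorem card_rowSet_lt_of_inconsistent {P E : List (List Γ)} {s₁ s₂ e : List Γ}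
    (h₁ : s₁ ∈ P) (h₂ : s₂ ∈ P) (hrow : row mem E s₁ = row mem E s₂)
    (hne : mem (s₁ ++ e) ≠ mem (s₂ ++ e)) :
    (rowSet mem P E).card < (rowSet mem P (e :: E)).card := by
  classical
  have himg : rowSet mem P E = (rowSet mem P (e :: E)).image List.tail := by
    ext x
    simp only [Finset.mem_image, mem_rowSet]
    constructor
    · rintro ⟨p, hp, rfl⟩
      exact ⟨_, ⟨p, hp, rfl⟩, rfl⟩
    · rintro ⟨_, ⟨p, hp, rfl⟩, rfl⟩
      exact ⟨p, hp, rfl⟩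
  rw [himg]
  refine lt_of_le_of_ne Finset.card_image_le fun hcard => hne ?_
  have hinj := Finset.card_image_iff.1 hcard
  have := hinj (mem_rowSet.2 ⟨s₁, h₁, rfl⟩) (mem_rowSet.2 ⟨s₂, h₂, rfl⟩) hrow
  rw [row_cons, row_cons] at this
  exact (List.cons.inj this).1

theorem card_rowSet_lt_of_unclosed {P E : List (List Γ)} {u : List Γ}
    (h : ∀ p ∈ P, row mem E p ≠ row mem E u) :
    (rowSet mem P E).card < (rowSet mem (u :: P) E).card := by
  refine Finset.card_lt_card ⟨fun x hx => ?_, fun hsub => ?_⟩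
  · obtain ⟨p, hp, rfl⟩ := mem_rowSet.1 hx
    exact mem_rowSet.2 ⟨p, .tail _ hp, rfl⟩
  · obtain ⟨p, hp, hpu⟩ := mem_rowSet.1 (hsub (mem_rowSet.2 ⟨u, .head _, rfl⟩))
    exact h p hp hpu

theorem rowSet_subset_append (Q P E : List (List Γ)) :
    rowSet mem P E ⊆ rowSet mem (Q ++ P) E := by
  intro x hx
  obtain ⟨p, hp, rfl⟩ := mem_rowSet.1 hx
  exact mem_rowSet.2 ⟨p, List.mem_append_right _ hp, rfl⟩

/-- The number of rows is bounded by the number of left quotients. -/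
theorem card_rowSet_le {L : Language Γ} (hmem : ∀ w, mem w = true ↔ w ∈ L)
    (hL : (Set.range L.leftQuotient).Finite) (P E : List (List Γ)) :
    (rowSet mem P E).card ≤ (Set.range L.leftQuotient).ncard := by
  classical
  let g : Language Γ → List Bool := fun K => E.map fun e => decide (e ∈ K)
  have hg : ∀ u, row mem E u = g (L.leftQuotient u) := by
    intro u
    refine List.map_congr_left fun e _ => ?_
    rw [Bool.eq_iff_iff, hmem, decide_eq_true_iff, Language.mem_leftQuotient]
  have hsub : (rowSet mem P E : Set (List Bool)) ⊆ g '' Set.range L.leftQuotient := by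
    intro x hx
    obtain ⟨p, -, rfl⟩ := mem_rowSet.1 (Finset.mem_coe.1 hx)
    exact ⟨_, ⟨p, rfl⟩, (hg p).symm⟩
  rw [← Set.ncard_coe_finset]
  exact (Set.ncard_le_ncard hsub (hL.image g)).trans (Set.ncard_image_le hL)

/-- The row of `u` must occur in the table, since `findIdx` gives all absent rows the same default
`P.length`. -/
theorem row_eq_of_rowIndex_eq {P E : List (List Γ)} {u v : List Γ}
    (hu : row mem E u ∈ rowSet mem P E) (h : rowIndex mem P E u = rowIndex mem P E v) :
    row mem E u = row mem E v := by
  obtain ⟨p, hp, hpu⟩ := mem_rowSet.1 hu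
  have hlt : rowIndex mem P E u < P.length :=
    List.findIdx_lt_length_of_exists ⟨p, hp, by simp [hpu]⟩
  have h1 := List.findIdx_getElem (w := hlt)
  have hlt' : rowIndex mem P E v < P.length := h ▸ hlt
  have h2 := List.findIdx_getElem (w := hlt')
  rw [beq_iff_eq] at h1 h2
  rw [← h1, ← h2]
  congr 2

theorem rowIndex_congr {P E : List (List Γ)} {u v : List Γ} (h : row mem E u = row mem E v) :
    rowIndex mem P E u = rowIndex mem P E v := by
  simp only [rowIndex, h]

variable [Fintype Γ]

/-- If the prefixes of `w` contribute no new row and extend the table consistently, then the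
conjectured automaton is correct on `w`. -/
theorem mem_lang_conjecture_iff {P E : List (List Γ)} {w : List Γ} (hE : [] ∈ E)
    (hcons : IsConsistentTable mem (w.inits ++ P) E)
    (hrows : rowSet mem (w.inits ++ P) E ⊆ rowSet mem P E) :
    w ∈ (conjecture mem P E).lang ↔ mem w = true := by
  have hmemP : ∀ u, u <+: w → row mem E u ∈ rowSet mem P E := fun u hu =>
    hrows (mem_rowSet.2 ⟨u, List.mem_append_left _ ((List.mem_inits u w).2 hu), rfl⟩)
  -- The coded automaton is nondeterministic; consistency of the extended table makes all
  -- transitions from the row of a prefix `u` under `a` lead to the row of `u ++ [a]`.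
  have heval : ∀ u, u <+: w →
      (conjecture mem P E).toNFA.eval u = {rowIndex mem P E u} := by
    intro u
    induction u using List.reverseRecOn with
    | nil => intro _; ext q; simp [AutomatonCode.toNFA, conjecture]
    | append_singleton u a ih =>
      intro hu
      have hu' : u <+: w := (List.prefix_append u [a]).trans hu
      rw [NFA.eval_append_singleton, ih hu', NFA.stepSet_singleton]
      have hstep : ∀ s ∈ P, row mem E s = row mem E u →
          rowIndex mem P E (s ++ [a]) = rowIndex mem P E (u ++ [a]) := fun s hs hsu =>
        rowIndex_congr (hcons s (List.mem_append_right _ hs) u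
          (List.mem_append_left _ ((List.mem_inits u w).2 hu')) hsu a)
      ext q
      simp only [AutomatonCode.toNFA, conjecture, Set.mem_ofPred_eq, List.mem_flatMap,
        List.mem_map, Finset.mem_toList, Finset.mem_univ, true_and, Prod.mk.injEq,
        Set.mem_singleton_iff]
      constructor
      · rintro ⟨s, hs, b, hsu, rfl, rfl⟩
        exact hstep s hs (row_eq_of_rowIndex_eq (mem_rowSet.2 ⟨s, hs, rfl⟩) hsu)
      · rintro rfl
        obtain ⟨s, hs, hsu⟩ := mem_rowSet.1 (hmemP u hu')
        exact ⟨s, hs, a, rowIndex_congr hsu, rfl, hstep s hs hsu⟩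
  -- The empty suffix makes acceptance a function of the row.
  have hlast : ∀ s, row mem E s = row mem E w → mem s = mem w := fun s hs => by
    simpa using mem_eq_of_row_eq hs hE
  rw [AutomatonCode.mem_lang, heval w List.prefix_rfl]
  simp only [conjecture, List.mem_map, List.mem_filter, Set.mem_singleton_iff]
  constructor
  · rintro ⟨_, ⟨s, ⟨hs, hms⟩, rfl⟩, hsw⟩
    rwa [← hlast s (row_eq_of_rowIndex_eq (mem_rowSet.2 ⟨s, hs, rfl⟩) hsw)]
  · intro hw
    obtain ⟨s, hs, hsw⟩ := mem_rowSet.1 (hmemP w List.prefix_rfl)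
    exact ⟨_, ⟨s, ⟨hs, by rwa [hlast s hsw]⟩, rfl⟩, rowIndex_congr hsw⟩

end ObservationTables

/-! ### Termination and correctness of runs -/

section Runs

variable {Γ : Type u} [Fintype Γ] {mem : List Γ → Bool}
  {equiv : AutomatonCode Γ → Option (List Γ) → Prop}

/-- In every configuration the empty word is a suffix of the table. -/
def LearnerState.HasEmptySuffix : LearnerState Γ → Prop
  | .table _ E => [] ∈ E
  | .output _ => True

/-- The number of distinct rows of the table of a configuration. -/
def LearnerState.rowCount (mem : List Γ → Bool) : LearnerState Γ → ℕ
  | .table P E => (rowSet mem P E).card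
  | .output _ => 0

theorem LStarStep.hasEmptySuffix {x y : LearnerState Γ} (h : LStarStep mem equiv x y)
    (hx : x.HasEmptySuffix) : y.HasEmptySuffix := by
  cases h with
  | inconsistent => exact List.mem_cons_of_mem _ hx
  | unclosed => exact hx
  | counterexample => exact hx
  | accept => trivial

/-- Two consecutive steps that lead to a further step increase the number of rows. -/
theorem LStarStep.rowCount_lt {x y z v : LearnerState Γ} (hx : x.HasEmptySuffix)
    (hequiv : ∀ c w, equiv c (some w) → ¬ (w ∈ c.lang ↔ mem w = true))
    (hxy : LStarStep mem equiv x y) (hyz : LStarStep mem equiv y z)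
    (hzv : LStarStep mem equiv z v) : x.rowCount mem < z.rowCount mem := by
  -- The further step out of `z` excludes that `z` is an output, whose row count is 0.
  have mono : ∀ {y z v : LearnerState Γ}, LStarStep mem equiv y z → LStarStep mem equiv z v →
      y.rowCount mem ≤ z.rowCount mem := by
    intro y z v hyz hzv
    cases hyz with
    | inconsistent P E s₁ s₂ a e h₁ h₂ he hrow hne =>
      exact (card_rowSet_lt_of_inconsistent h₁ h₂ hrow hne).le
    | unclosed P E s a hs h => exact (card_rowSet_lt_of_unclosed h).le
    | counterexample P E w => exact Finset.card_le_card (rowSet_subset_append _ _ _)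
    | accept => cases hzv
  cases hxy with
  | inconsistent P E s₁ s₂ a e h₁ h₂ he hrow hne =>
    exact (card_rowSet_lt_of_inconsistent h₁ h₂ hrow hne).trans_le (mono hyz hzv)
  | unclosed P E s a hs h => exact (card_rowSet_lt_of_unclosed h).trans_le (mono hyz hzv)
  | accept => cases hyz
  | counterexample P E w hcl hco hw =>
    have hle : (rowSet mem P E).card ≤ (rowSet mem (w.inits ++ P) E).card :=
      Finset.card_le_card (rowSet_subset_append _ _ _)
    cases hyz with
    | inconsistent _ _ s₁ s₂ a e h₁ h₂ he hrow hne =>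
      exact hle.trans_lt (card_rowSet_lt_of_inconsistent h₁ h₂ hrow hne)
    | unclosed _ _ s a hs h => exact hle.trans_lt (card_rowSet_lt_of_unclosed h)
    | accept => cases hzv
    | counterexample _ _ w' hcl' hco' hw' =>
      -- For two counterexamples in a row, the table between them is consistent. Had the first
      -- counterexample `w` added no row, the first conjecture would already be correct on `w`.
      refine lt_of_lt_of_le ?_ (Finset.card_le_card (rowSet_subset_append w'.inits _ _))
      refine lt_of_le_of_ne hle fun heq => hequiv _ _ hw ?_
      exact mem_lang_conjecture_iff hx hco'
        (Finset.eq_of_subset_of_card_le (rowSet_subset_append _ _ _) heq.ge).ge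

/-- If the membership oracle decides a regular language and all counterexamples are genuine, then
every run of `L*` is finite. -/
theorem not_exists_infinite_run {L : Language Γ} (hL : L.IsRegular)
    (hmem : ∀ w, mem w = true ↔ w ∈ L)
    (hequiv : ∀ c w, equiv c (some w) → ¬ (w ∈ c.lang ↔ mem w = true)) :
    ¬ ∃ r : ℕ → LearnerState Γ, r 0 = LearnerState.init ∧
      ∀ n, LStarStep mem equiv (r n) (r (n + 1)) := by
  rintro ⟨r, hr0, hr⟩
  have hempty : ∀ n, (r n).HasEmptySuffix := by
    intro n
    induction n with
    | zero => rw [hr0]; exact List.mem_singleton.2 rfl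
    | succ n ih => exact (hr n).hasEmptySuffix ih
  have hgrow : ∀ n, n ≤ (r (2 * n)).rowCount mem := by
    intro n
    induction n with
    | zero => exact Nat.zero_le _
    | succ n ih =>
      exact Nat.succ_le_of_lt (ih.trans_lt
        (LStarStep.rowCount_lt (hempty _) hequiv (hr _) (hr _) (hr _)))
  have hbound : ∀ x : LearnerState Γ,
      x.rowCount mem ≤ (Set.range L.leftQuotient).ncard := by
    rintro (⟨P, E⟩ | c)
    · exact card_rowSet_le hmem hL.finite_range_leftQuotient P E
    · exact Nat.zero_le _
  have := (hgrow ((Set.range L.leftQuotient).ncard + 1)).trans (hbound _)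
  omega

/-- A step is possible from every table when every equivalence query has an answer. -/
theorem exists_step_table (hans : ∀ c, ∃ a, equiv c a) (P E : List (List Γ)) :
    ∃ y, LStarStep mem equiv (.table P E) y := by
  by_cases hcl : IsClosedTable mem P E
  · by_cases hco : IsConsistentTable mem P E
    · obtain ⟨_ | w, hw⟩ := hans (conjecture mem P E)
      · exact ⟨_, .accept P E hcl hco hw⟩
      · exact ⟨_, .counterexample P E w hcl hco hw⟩
    · unfold IsConsistentTable at hco
      push Not at hco
      obtain ⟨s₁, h₁, s₂, h₂, hrow, a, hne⟩ := hco
      obtain ⟨e, he, hne'⟩ : ∃ e ∈ E, mem (s₁ ++ a :: e) ≠ mem (s₂ ++ a :: e) := by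
        by_contra! hall
        refine hne (List.map_congr_left fun e he => ?_)
        simpa using hall e he
      exact ⟨_, .inconsistent P E s₁ s₂ a e h₁ h₂ he hrow hne'⟩
  · unfold IsClosedTable at hcl
    push Not at hcl
    obtain ⟨s, hs, a, h⟩ := hcl
    exact ⟨_, .unclosed P E s a hs h⟩

theorem equiv_none_of_mayReturn {c : AutomatonCode Γ} (h : MayReturn mem equiv c) :
    equiv c none := by
  rcases Relation.ReflTransGen.cases_tail h with h | ⟨x, -, hx⟩
  · exact absurd h (by simp [LearnerState.init])
  · cases hx with
    | accept P E hcl hco hnone => exact hnone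

/-- A relation without infinite descending path from `x` has a terminal point reachable
from `x`. -/
theorem exists_terminal_of_not_infinite {X : Type*} {r : X → X → Prop} {x : X}
    (h : ¬ ∃ f : ℕ → X, f 0 = x ∧ ∀ n, r (f n) (f (n + 1))) :
    ∃ y, Relation.ReflTransGen r x y ∧ ∀ z, ¬ r y z := by
  by_contra! hn
  have : ∀ y : {y // Relation.ReflTransGen r x y},
      ∃ z : {y // Relation.ReflTransGen r x y}, r y.1 z.1 := fun ⟨y, hy⟩ => by
    obtain ⟨z, hz⟩ := hn y hy
    exact ⟨⟨z, hy.tail hz⟩, hz⟩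
  choose g hg using this
  refine h ⟨fun n => (g^[n] ⟨x, .refl⟩).1, rfl, fun n => ?_⟩
  simp only [Function.iterate_succ_apply']
  exact hg _

/-- `L*` with a membership oracle for `L` and an equivalence oracle whose answers are sound and
always available terminates, on every run, with an automaton for `L` iff `L` is regular. -/
theorem terminatesReturning_iff {L : Language Γ} (hmem : ∀ w, mem w = true ↔ w ∈ L)
    (hsome : ∀ c w, equiv c (some w) → ¬ (w ∈ c.lang ↔ mem w = true))
    (hnone : ∀ c, equiv c none → c.lang = L) (hans : ∀ c, ∃ a, equiv c a) :
    TerminatesReturning mem equiv L ↔ L.IsRegular := by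
  constructor
  · rintro ⟨hfin, hout⟩
    obtain ⟨y, hy, hterm⟩ := exists_terminal_of_not_infinite hfin
    obtain ⟨c, -, rfl⟩ := hout y hy hterm
    exact c.isRegular_lang
  · intro hL
    refine ⟨not_exists_infinite_run hL hmem hsome, ?_⟩
    rintro (⟨P, E⟩ | c) hx hterm
    · obtain ⟨y, hy⟩ := exists_step_table (mem := mem) hans P E
      exact absurd hy (hterm y)
    · exact ⟨c, rfl, hnone c (equiv_none_of_mayReturn hx)⟩

end Runs

/-! ### Primitive recursive simulation of automata -/

section PrimitiveRecursion

variable {Γ : Type u}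

theorem _root_.PrimrecPred.iff {A : Type*} [Primcodable A] {p q : A → Prop} (hp : PrimrecPred p)
    (hq : PrimrecPred q) : PrimrecPred fun a => (p a ↔ q a) :=
  ((hp.and hq).or (hp.not.and hq.not)).of_eq fun a => by tauto

theorem _root_.Primrec₂.nat_pow : Primrec₂ ((· ^ ·) : ℕ → ℕ → ℕ) :=
  Primrec₂.unpaired'.1 Nat.Primrec.pow

/-- The states reached from a list of states by a letter. -/
noncomputable def AutomatonCode.stepList (c : AutomatonCode Γ) (X : List ℕ) (a : Γ) : List ℕ :=
  open Classical in
  c.2.1.filterMap fun t => if t.1 ∈ X ∧ t.2.1 = a then some t.2.2 else none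

theorem AutomatonCode.mem_foldl_stepList (c : AutomatonCode Γ) (w : List Γ) (q : ℕ) :
    q ∈ w.foldl c.stepList c.1 ↔ q ∈ c.toNFA.eval w := by
  induction w using List.reverseRecOn generalizing q with
  | nil => exact Iff.rfl
  | append_singleton w a ih =>
    rw [NFA.eval_append_singleton, NFA.mem_stepSet, List.foldl_append, List.foldl_cons,
      List.foldl_nil, AutomatonCode.stepList, List.mem_filterMap]
    constructor
    · rintro ⟨⟨p, b, q'⟩, ht, hif⟩
      split_ifs at hif with hc
      obtain ⟨hp, rfl⟩ := hc
      obtain rfl : q' = q := Option.some.inj hif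
      exact ⟨p, (ih p).1 hp, ht⟩
    · rintro ⟨p, hp, ht⟩
      exact ⟨(p, a, q), ht, if_pos ⟨(ih p).2 hp, rfl⟩⟩

/-- The list of all words of a given length. -/
noncomputable def wordsOfLength (Γ : Type u) [Fintype Γ] : ℕ → List (List Γ)
  | 0 => [[]]
  | k + 1 => (wordsOfLength Γ k).flatMap fun w =>
      (Finset.univ : Finset Γ).toList.map fun a => a :: w

theorem mem_wordsOfLength [Fintype Γ] {k : ℕ} {w : List Γ} :
    w ∈ wordsOfLength Γ k ↔ w.length = k := by
  induction k generalizing w with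
  | zero => simp [wordsOfLength]
  | succ k ih =>
    simp only [wordsOfLength, List.mem_flatMap, ih, List.mem_map, Finset.mem_toList,
      Finset.mem_univ, true_and]
    constructor
    · rintro ⟨v, rfl, a, rfl⟩
      rfl
    · intro h
      obtain ⟨a, v, rfl⟩ := List.exists_cons_of_length_eq_add_one h
      exact ⟨v, by simpa using h, a, rfl⟩

variable [Primcodable Γ]

theorem _root_.PrimrecRel.mem_list [DecidableEq Γ] :
    PrimrecRel fun (a : Γ) (l : List Γ) => a ∈ l :=
  ((Primrec.eq (α := Γ)).exists_mem_list.swap).of_eq fun a l => by simp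

/-- Acceptance of a word by a coded automaton is primitive recursive. -/
theorem AutomatonCode.primrecRel_mem_lang :
    PrimrecRel fun (c : AutomatonCode Γ) (w : List Γ) => w ∈ c.lang := by
  classical
  have hstep : Primrec fun x : AutomatonCode Γ × List ℕ × Γ => x.1.stepList x.2.1 x.2.2 := by
    refine Primrec.listFilterMap (f := fun x : AutomatonCode Γ × List ℕ × Γ => x.1.2.1)
      (Primrec.fst.comp (Primrec.snd.comp Primrec.fst)) ?_
    refine Primrec.ite (PrimrecPred.and ?_ ?_)
      (Primrec.option_some.comp (Primrec.snd.comp (Primrec.snd.comp Primrec.snd)))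
      (Primrec.const none)
    · exact PrimrecRel.mem_list.comp (Primrec.fst.comp Primrec.snd)
        (Primrec.fst.comp (Primrec.snd.comp Primrec.fst))
    · exact Primrec.eq.comp (Primrec.fst.comp (Primrec.snd.comp Primrec.snd))
        (Primrec.snd.comp (Primrec.snd.comp Primrec.fst))
  have heval : Primrec fun x : AutomatonCode Γ × List Γ => x.2.foldl x.1.stepList x.1.1 :=
    Primrec.list_foldl (f := fun x : AutomatonCode Γ × List Γ => x.2)
      (g := fun x => x.1.1) (h := fun x y => x.1.stepList y.1 y.2)
      Primrec.snd (Primrec.fst.comp Primrec.fst)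
      (hstep.comp ((Primrec.fst.comp Primrec.fst).pair Primrec.snd))
  have h : PrimrecPred fun x : AutomatonCode Γ × List Γ =>
      ∃ q ∈ x.1.2.2, q ∈ x.2.foldl x.1.stepList x.1.1 :=
    (PrimrecRel.mem_list (Γ := ℕ)).exists_mem_list.comp
      (Primrec.snd.comp (Primrec.snd.comp Primrec.fst)) heval
  refine h.of_eq fun x => ?_
  simp only [AutomatonCode.mem_foldl_stepList]
  exact AutomatonCode.mem_lang.symm

theorem primrec_wordsOfLength [Fintype Γ] : Primrec (wordsOfLength Γ) := by
  have hcons : Primrec fun w : List Γ =>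
      (Finset.univ : Finset Γ).toList.map fun a => a :: w :=
    Primrec.list_map (f := fun _ : List Γ => (Finset.univ : Finset Γ).toList)
      (g := fun w a => a :: w) (Primrec.const _) (Primrec.list_cons.comp₂ Primrec₂.right
        Primrec₂.left)
  have hstep : Primrec fun W : List (List Γ) => W.flatMap fun w =>
      (Finset.univ : Finset Γ).toList.map fun a => a :: w :=
    Primrec.list_flatMap (f := fun W : List (List Γ) => W) (g := fun _ w =>
      (Finset.univ : Finset Γ).toList.map fun a => a :: w) Primrec.id (hcons.comp Primrec.snd)
  refine (Primrec.nat_rec₁ [[]] (hstep.comp₂ Primrec₂.right)).of_eq fun k => ?_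
  induction k with
  | zero => rfl
  | succ k ih => simp only [wordsOfLength, ← ih]

end PrimitiveRecursion

/-! ### Sets of words as languages over pairs -/

section SecondComponent

variable {α : Type u}

/-- The words over `α × α` whose second component lies in `X`. -/
def liftSnd (X : Language α) : Language (α × α) :=
  {w | w.map Prod.snd ∈ X}

theorem mem_liftSnd {X : Language α} {w : List (α × α)} :
    w ∈ liftSnd X ↔ w.map Prod.snd ∈ X := Iff.rfl

theorem isRegular_liftSnd {X : Language α} (hX : X.IsRegular) : (liftSnd X).IsRegular := by
  obtain ⟨σ, _, M, rfl⟩ := hX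
  exact ⟨σ, inferInstance, M.comap Prod.snd, M.accepts_comap _⟩

theorem zip_mem_uniformImage {F : Language α → Language α} {L : Language (α × α)} {s t : List α}
    (h : s.length = t.length) :
    s.zip t ∈ uniformImage F L ↔ t ∈ F {u | relOf L s u} := by
  constructor
  · rintro ⟨s', t', h', he, hm⟩
    obtain ⟨rfl, rfl⟩ := zip_injective_of_length h h' he
    exact hm
  · exact fun hm => ⟨s, t, h, rfl, hm⟩

/-- The fibre of `liftSnd X` over `s` is `X` cut to the length of `s`, and `F` commutes with this
cut. Thus iterating the automaton transformation of uniform regularity yields automata for all the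
stages. -/
theorem uniformImage_liftSnd {F : Language α → Language α}
    (hlen : IndependentlyLengthPreserving F) (X : Language α) :
    uniformImage F (liftSnd X) = liftSnd (F X) := by
  ext w
  obtain ⟨s, t, h, rfl⟩ : ∃ s t : List α, s.length = t.length ∧ w = s.zip t :=
    ⟨_, _, by simp, (zip_map_fst_snd w).symm⟩
  rw [zip_mem_uniformImage h, mem_liftSnd, List.map_snd_zip h.ge]
  have : ({u | relOf (liftSnd X) s u} : Language α) = restrictLength X s.length := by
    ext u
    constructor
    · rintro ⟨hl, hu⟩
      rw [mem_liftSnd, List.map_snd_zip hl.ge] at hu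
      exact ⟨hu, hl.symm⟩
    · rintro ⟨hu, hl⟩
      refine ⟨hl.symm, ?_⟩
      rwa [mem_liftSnd, List.map_snd_zip hl.le]
  rw [this, hlen, mem_restrictLength]
  exact and_iff_left h.symm

end SecondComponent

/-! ### A length bound by pumping -/

section Pigeonhole

variable {Δ Γ : Type u}

/-- An upper bound for the number of states of the automaton of a code. -/
def AutomatonCode.size (c : AutomatonCode Γ) : ℕ := c.1.length + c.2.1.length

theorem AutomatonCode.card_support_le (c : AutomatonCode Γ) : c.support.card ≤ c.size :=
  (List.toFinset_card_le _).trans (by simp [AutomatonCode.size])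

/-- A property of words that depends only on acceptance of letterwise images by three coded automata
holds for a word of bounded length if it holds at all. -/
theorem exists_length_lt_of_acceptance_invariant [Fintype (Δ → Γ)] (c d e : AutomatonCode Γ)
    {P : List Δ → Prop}
    (hP : ∀ u v : List Δ, (∀ p : Δ → Γ, (u.map p ∈ c.lang ↔ v.map p ∈ c.lang) ∧
      (u.map p ∈ d.lang ↔ v.map p ∈ d.lang) ∧ (u.map p ∈ e.lang ↔ v.map p ∈ e.lang)) →
      P u → P v) (hex : ∃ u, P u) :
    ∃ u, P u ∧ u.length < (2 ^ (c.size + d.size + e.size)) ^ Fintype.card (Δ → Γ) + 1 := by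
  classical
  let reach : AutomatonCode Γ → List Γ → Finset ℕ := fun c w =>
    c.support.filter (· ∈ c.toNFA.eval w)
  have hreach : ∀ (c : AutomatonCode Γ) (w : List Γ), (reach c w : Set ℕ) = c.toNFA.eval w := by
    intro c w
    ext q
    simp only [reach, Finset.coe_filter, Set.mem_ofPred_eq]
    exact and_iff_right_of_imp fun h => c.eval_subset_support w h
  have hreach_append : ∀ (c : AutomatonCode Γ) (u v w : List Γ), reach c u = reach c v →
      (u ++ w ∈ c.lang ↔ v ++ w ∈ c.lang) := by
    intro c u v w h
    have : c.toNFA.eval (u ++ w) = c.toNFA.eval (v ++ w) := by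
      have h' : c.toNFA.eval u = c.toNFA.eval v := by rw [← hreach, h, hreach]
      rw [NFA.eval, NFA.evalFrom_append, NFA.evalFrom_append]
      exact congrArg (fun A => c.toNFA.evalFrom A w) h'
    rw [AutomatonCode.mem_lang, AutomatonCode.mem_lang, this]
  -- The profile of a word: the state sets reached in the three automata under every letterwise map.
  -- The bound counts the possible profiles.
  let st : List Δ → (Δ → Γ) → Finset ℕ × Finset ℕ × Finset ℕ := fun u p =>
    (reach c (u.map p), reach d (u.map p), reach e (u.map p))
  let range : Finset ((Δ → Γ) → Finset ℕ × Finset ℕ × Finset ℕ) :=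
    Fintype.piFinset fun _ => c.support.powerset ×ˢ d.support.powerset ×ˢ e.support.powerset
  have hst : ∀ u, st u ∈ range := by
    intro u
    simp only [range, st, Fintype.mem_piFinset, Finset.mem_product, Finset.mem_powerset, reach]
    exact fun p => ⟨Finset.filter_subset _ _, Finset.filter_subset _ _, Finset.filter_subset _ _⟩
  have hcard : range.card ≤ (2 ^ (c.size + d.size + e.size)) ^ Fintype.card (Δ → Γ) := by
    simp only [range, Fintype.card_piFinset, Finset.card_product, Finset.card_powerset,
      Finset.prod_const, Finset.card_univ, ← pow_add]
    refine Nat.pow_le_pow_left (Nat.pow_le_pow_right (by norm_num) ?_) _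
    have := c.card_support_le
    have := d.card_support_le
    have := e.card_support_le
    omega
  obtain ⟨k, ⟨u, hu, rfl⟩, hmin⟩ : ∃ k, (∃ u, P u ∧ u.length = k) ∧
      ∀ v, P v → k ≤ v.length := by
    have hex' : ∃ k, ∃ u, P u ∧ u.length = k := hex.imp' List.length fun u hu => ⟨u, hu, rfl⟩
    exact ⟨Nat.find hex', Nat.find_spec hex', fun v hv => Nat.find_min' hex' ⟨v, hv, rfl⟩⟩
  refine ⟨u, hu, ?_⟩
  by_contra! hlong
  obtain ⟨i, hi, j, hj, hij, heq⟩ := Finset.exists_ne_map_eq_of_card_lt_of_maps_to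
    (s := Finset.range (u.length + 1)) (t := range) (f := fun i => st (u.take i))
    (by rw [Finset.card_range]; omega) (fun i _ => hst _)
  -- Removing the segment between two prefixes of equal profile preserves `P`, contradicting the
  -- minimal length of `u`.
  have cut : ∀ i j, i < j → j ≤ u.length → st (u.take i) = st (u.take j) → False := by
    intro i j hij hj heq
    have hP' : P (u.take i ++ u.drop j) := by
      refine hP u _ (fun p => ?_) hu
      have hp := congrFun heq p
      simp only [st, Prod.mk.injEq] at hp
      have hu' : u.map p = (u.take j).map p ++ (u.drop j).map p := by
        rw [← List.map_append, List.take_append_drop]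
      rw [hu', List.map_append]
      exact ⟨(hreach_append c _ _ _ hp.1).symm, (hreach_append d _ _ _ hp.2.1).symm,
        (hreach_append e _ _ _ hp.2.2).symm⟩
    have := hmin _ hP'
    simp only [List.length_append, List.length_take, List.length_drop] at this
    omega
  rw [Finset.mem_range] at hi hj
  rcases lt_or_gt_of_ne hij with h | h
  · exact cut i j h (by omega) heq
  · exact cut j i h (by omega) heq.symm

end Pigeonhole

/-! ### Deciding refutation with automata -/

section RefutationByAutomata

variable {α : Type u}

/-- The quantifier-free part of the refutation criterion for the language of `c`, evaluated at the
three components of `u`, where `d` recognizes the image under `F` and `e` recognizes the state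
space in the second component. -/
def IsRefutation (c d e : AutomatonCode (α × α)) (u : List (α × α × α)) : Prop :=
  (u.map (fun x => (x.1, x.2.1)) ∈ c.lang ∧
    ¬ (u.map (fun x => (x.1, x.1)) ∈ e.lang ∧ u.map (fun x => (x.2.1, x.2.1)) ∈ e.lang)) ∨
  (u.map (fun x => (x.1, x.1)) ∈ e.lang ∧ ¬ u.map (fun x => (x.1, x.1)) ∈ c.lang) ∨
  (u.map (fun x => (x.1, x.2.1)) ∈ c.lang ∧ u.map (fun x => (x.2.1, x.2.2)) ∈ c.lang ∧
    ¬ u.map (fun x => (x.1, x.2.2)) ∈ c.lang) ∨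
  (u.map (fun x => (x.1, x.1)) ∈ e.lang ∧ u.map (fun x => (x.2.1, x.2.1)) ∈ e.lang ∧
    ¬ u.map (fun x => (x.1, x.2.1)) ∈ c.lang ∧ ¬ u.map (fun x => (x.2.1, x.1)) ∈ c.lang) ∨
  (u.map (fun x => (x.1, x.2.1)) ∈ c.lang ∧ u.map (fun x => (x.1, x.2.2)) ∈ c.lang ∧
    ¬ (¬ u.map (fun x => (x.2.1, x.1)) ∈ c.lang ↔ u.map (fun x => (x.1, x.2.1)) ∈ d.lang) ∧
    (¬ u.map (fun x => (x.2.2, x.1)) ∈ c.lang ∨ ¬ u.map (fun x => (x.1, x.2.2)) ∈ d.lang))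

theorem exists_components_iff {P : List α → List α → List α → Prop} {k : ℕ} :
    (∃ u : List (α × α × α), u.length = k ∧
      P (u.map fun x => x.1) (u.map fun x => x.2.1) (u.map fun x => x.2.2)) ↔
    ∃ s t r : List α, s.length = k ∧ t.length = k ∧ r.length = k ∧ P s t r := by
  constructor
  · rintro ⟨u, hu, h⟩
    exact ⟨_, _, _, by simpa using hu, by simpa using hu, by simpa using hu, h⟩
  · rintro ⟨s, t, r, hs, ht, hr, h⟩
    have h2 : (t.zip r).length = k := by simp [ht, hr]
    have e1 : ((s.zip (t.zip r)).map fun x => x.1) = s := List.map_fst_zip (by omega)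
    have e2 : ((s.zip (t.zip r)).map fun x => x.2) = t.zip r := List.map_snd_zip (by omega)
    have e3 : ((s.zip (t.zip r)).map fun x => x.2.1) = t := by
      have := congrArg (List.map Prod.fst) e2
      rwa [List.map_map, List.map_fst_zip (by omega)] at this
    have e4 : ((s.zip (t.zip r)).map fun x => x.2.2) = r := by
      have := congrArg (List.map Prod.snd) e2
      rwa [List.map_map, List.map_snd_zip (by omega)] at this
    exact ⟨s.zip (t.zip r), by simp [hs, ht, hr], by rwa [e1, e3, e4]⟩

theorem refutes_iff_exists_isRefutation {F : Language α → Language α} {S : Language α}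
    {c d e : AutomatonCode (α × α)} (hd : d.lang = uniformImage F c.lang)
    (he : e.lang = liftSnd S) (k : ℕ) :
    Refutes F S (relOf c.lang) k ↔ ∃ u, u.length = k ∧ IsRefutation c d e u := by
  simp only [IsRefutation, hd, he, mem_liftSnd, List.map_map, Function.comp_def]
  simp only [← List.zip_map']
  rw [exists_components_iff (P := fun s t r =>
    (s.zip t ∈ c.lang ∧ ¬ (s ∈ S ∧ t ∈ S)) ∨ (s ∈ S ∧ ¬ s.zip s ∈ c.lang) ∨
    (s.zip t ∈ c.lang ∧ t.zip r ∈ c.lang ∧ ¬ s.zip r ∈ c.lang) ∨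
    (s ∈ S ∧ t ∈ S ∧ ¬ s.zip t ∈ c.lang ∧ ¬ t.zip s ∈ c.lang) ∨
    (s.zip t ∈ c.lang ∧ s.zip r ∈ c.lang ∧
      ¬ (¬ t.zip s ∈ c.lang ↔ s.zip t ∈ uniformImage F c.lang) ∧
      (¬ r.zip s ∈ c.lang ∨ ¬ s.zip r ∈ uniformImage F c.lang)))]
  have hrel : ∀ {s t : List α}, s.length = k → t.length = k →
      (relOf c.lang s t ↔ s.zip t ∈ c.lang) := fun hs ht => relOf_iff_zip_mem (hs.trans ht.symm)
  -- `uniformImage` applies `F` to `{u | R s u}`, whereas the criterion uses its intersection with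
  -- `S`. The two sets agree at length `k` unless condition 1 holds, in which case both sides are
  -- true anyway.
  by_cases h1 : ∃ s t : List α, s.length = k ∧ t.length = k ∧ relOf c.lang s t ∧
      ¬ (s ∈ S ∧ t ∈ S)
  · refine iff_of_true (.inl h1) ?_
    obtain ⟨s, t, hs, ht, hst, hn⟩ := h1
    exact ⟨s, t, t, hs, ht, ht, .inl ⟨(hrel hs ht).1 hst, hn⟩⟩
  have himg : ∀ s t : List α, s.length = k → t.length = k →
      (t ∈ F (upClosure S (relOf c.lang) s) ↔ s.zip t ∈ uniformImage F c.lang) := by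
    intro s t hs ht
    rw [zip_mem_uniformImage (hs.trans ht.symm)]
    have : upClosure S (relOf c.lang) s = {u | relOf c.lang s u} := by
      ext u
      refine ⟨fun h => h.2, fun h => ⟨?_, h⟩⟩
      by_contra hu
      exact h1 ⟨s, u, hs, (relOf_length h).symm.trans hs, h, fun h' => hu h'.2⟩
    rw [this]
  constructor
  · rintro (h | ⟨s, hs, hsS, hn⟩ | ⟨s₁, s₂, s₃, h₁, h₂, h₃, h₁₂, h₂₃, hn⟩ |
      ⟨s, t, hs, ht, hsS, htS, hn, hn'⟩ | ⟨s, t₁, t₂, hs, ht₁, ht₂, h₁, h₂, hn, hn'⟩)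
    · exact absurd h h1
    · rw [hrel hs hs] at hn
      exact ⟨s, s, s, hs, hs, hs, .inr (.inl ⟨hsS, hn⟩)⟩
    · rw [hrel h₁ h₂] at h₁₂
      rw [hrel h₂ h₃] at h₂₃
      rw [hrel h₁ h₃] at hn
      exact ⟨s₁, s₂, s₃, h₁, h₂, h₃, .inr (.inr (.inl ⟨h₁₂, h₂₃, hn⟩))⟩
    · rw [hrel hs ht] at hn
      rw [hrel ht hs] at hn'
      exact ⟨s, t, t, hs, ht, ht, .inr (.inr (.inr (.inl ⟨hsS, htS, hn, hn'⟩)))⟩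
    · rw [hrel hs ht₁] at h₁
      rw [hrel hs ht₂] at h₂
      rw [himg s t₁ hs ht₁, hrel ht₁ hs] at hn
      rw [himg s t₂ hs ht₂, hrel ht₂ hs] at hn'
      exact ⟨s, t₁, t₂, hs, ht₁, ht₂, .inr (.inr (.inr (.inr ⟨h₁, h₂, hn, hn'⟩)))⟩
  · rintro ⟨s, t, r, hs, ht, hr, h⟩
    rw [← hrel hs ht, ← hrel hs hs, ← hrel ht hr, ← hrel hs hr, ← hrel ht hs, ← hrel hr hs,
      ← himg s t hs ht, ← himg s r hs hr] at h
    rcases h with ⟨hst, hn⟩ | ⟨hsS, hn⟩ | ⟨hst, htr, hn⟩ | ⟨hsS, htS, hn, hn'⟩ |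
      ⟨hst, hsr, hn, hn'⟩
    · exact absurd ⟨s, t, hs, ht, hst, hn⟩ h1
    · exact .inr (.inl ⟨s, hs, hsS, hn⟩)
    · exact .inr (.inr (.inl ⟨s, t, r, hs, ht, hr, hst, htr, hn⟩))
    · exact .inr (.inr (.inr (.inl ⟨s, t, hs, ht, hsS, htS, hn, hn'⟩)))
    · exact .inr (.inr (.inr (.inr ⟨s, t, r, hs, ht, hr, hst, hsr, hn, hn'⟩)))

variable [Fintype α] [Primcodable α]

theorem primrecPred_isRefutation (e : AutomatonCode (α × α)) :
    PrimrecPred fun x : (AutomatonCode (α × α) × AutomatonCode (α × α)) × List (α × α × α) =>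
      IsRefutation x.1.1 x.1.2 e x.2 := by
  have hmap : ∀ p : α × α × α → α × α, Primrec fun x :
      (AutomatonCode (α × α) × AutomatonCode (α × α)) × List (α × α × α) => x.2.map p :=
    fun p => Primrec.list_map Primrec.snd ((Primrec.dom_finite p).comp Primrec.snd)
  have hc : ∀ p : α × α × α → α × α, PrimrecPred fun x :
      (AutomatonCode (α × α) × AutomatonCode (α × α)) × List (α × α × α) =>
        x.2.map p ∈ x.1.1.lang := fun p =>
    AutomatonCode.primrecRel_mem_lang.comp (Primrec.fst.comp Primrec.fst) (hmap p)
  have hd : ∀ p : α × α × α → α × α, PrimrecPred fun x :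
      (AutomatonCode (α × α) × AutomatonCode (α × α)) × List (α × α × α) =>
        x.2.map p ∈ x.1.2.lang := fun p =>
    AutomatonCode.primrecRel_mem_lang.comp (Primrec.snd.comp Primrec.fst) (hmap p)
  have he : ∀ p : α × α × α → α × α, PrimrecPred fun x :
      (AutomatonCode (α × α) × AutomatonCode (α × α)) × List (α × α × α) =>
        x.2.map p ∈ e.lang := fun p =>
    AutomatonCode.primrecRel_mem_lang.comp (Primrec.const e) (hmap p)
  exact ((hc _).and ((he _).and (he _)).not).or (((he _).and (hc _).not).or
    (((hc _).and ((hc _).and (hc _).not)).or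
      (((he _).and ((he _).and ((hc _).not.and (hc _).not))).or
        ((hc _).and ((hc _).and (((hc _).not.iff (hd _)).not.and ((hc _).not.or (hd _).not)))))))

/-- Refutation at a given length is primitive recursive. -/
theorem primrecRel_exists_isRefutation (e : AutomatonCode (α × α)) :
    PrimrecRel fun (k : ℕ) (x : AutomatonCode (α × α) × AutomatonCode (α × α)) =>
      ∃ u, u.length = k ∧ IsRefutation x.1 x.2 e u := by
  have h : PrimrecRel fun (u : List (α × α × α))
      (x : AutomatonCode (α × α) × AutomatonCode (α × α)) => IsRefutation x.1 x.2 e u :=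
    (primrecPred_isRefutation e).comp (Primrec.snd.pair Primrec.fst)
  refine (h.exists_mem_list.comp (primrec_wordsOfLength.comp Primrec.fst)
    Primrec.snd).of_eq fun x => ?_
  simp only [mem_wordsOfLength]

/-- Refutation at some length is primitive recursive. -/
theorem primrecPred_exists_isRefutation (e : AutomatonCode (α × α)) :
    PrimrecPred fun x : AutomatonCode (α × α) × AutomatonCode (α × α) =>
      ∃ u, IsRefutation x.1 x.2 e u := by
  classical
  have hsize : Primrec fun c : AutomatonCode (α × α) => c.size :=
    Primrec.nat_add.comp (Primrec.list_length.comp Primrec.fst)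
      (Primrec.list_length.comp (Primrec.fst.comp Primrec.snd))
  have hbound : Primrec fun x : AutomatonCode (α × α) × AutomatonCode (α × α) =>
      (2 ^ (x.1.size + x.2.size + e.size)) ^ Fintype.card (α × α × α → α × α) + 1 :=
    Primrec.succ.comp (Primrec₂.nat_pow.comp (Primrec₂.nat_pow.comp (Primrec.const 2)
      (Primrec.nat_add.comp (Primrec.nat_add.comp (hsize.comp Primrec.fst)
        (hsize.comp Primrec.snd)) (Primrec.const _))) (Primrec.const _))
  refine ((primrecRel_exists_isRefutation e).exists_mem_list.comp
    (Primrec.list_range.comp hbound) Primrec.id).of_eq fun x => ?_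
  simp only [List.mem_range]
  constructor
  · rintro ⟨k, -, u, -, hu⟩
    exact ⟨u, hu⟩
  · intro hex
    obtain ⟨u, hu, hlt⟩ := exists_length_lt_of_acceptance_invariant x.1 x.2 e
      (P := IsRefutation x.1 x.2 e) (fun u v huv => by
        simp only [IsRefutation, fun p => (huv p).1, fun p => (huv p).2.1, fun p => (huv p).2.2]
        exact id) hex
    exact ⟨u.length, hlt, u, rfl, hu⟩

end RefutationByAutomata

/-! ### Computability of the oracles -/

section ComputableOracles

/-- Bounded universal quantification over the iterates of a computable function. -/
theorem exists_computable_forall_iterate {A B : Type*} [Primcodable A] [Primcodable B] {f : A → A}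
    (hf : Computable f) (e : A) {good : A → B → Bool} (hgood : Computable₂ good)
    {init : B → Bool} (hinit : Computable init) {N : B → ℕ} (hN : Computable N) :
    ∃ g : B → Bool, Computable g ∧
      ∀ b, g b = true ↔ init b = true ∧ ∀ k < N b, good (f^[k] e) b = true := by
  let loop : B → ℕ → A × Bool := fun b n =>
    Nat.rec (e, init b) (fun _ p => (f p.1, p.2 && good p.1 b)) n
  have hloop : ∀ b n, (loop b n).1 = f^[n] e ∧ ((loop b n).2 = true ↔
      init b = true ∧ ∀ k < n, good (f^[k] e) b = true) := by
    intro b n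
    induction n with
    | zero => exact ⟨rfl, by simp [loop]⟩
    | succ n ih =>
      have h1 : (loop b (n + 1)).1 = f (loop b n).1 := rfl
      have h2 : (loop b (n + 1)).2 = ((loop b n).2 && good (loop b n).1 b) := rfl
      rw [h1, h2, ih.1, Function.iterate_succ_apply', Bool.and_eq_true, ih.2, and_assoc]
      refine ⟨rfl, and_congr_right fun _ => ?_⟩
      simp only [Nat.lt_succ_iff_lt_or_eq, or_imp, forall_and, forall_eq]
  have hfst : Computable fun x : B × ℕ × A × Bool => x.2.2.1 :=
    Computable.fst.comp (Computable.snd.comp Computable.snd)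
  have hstep : Computable₂ fun (b : B) (x : ℕ × A × Bool) =>
      (f x.2.1, x.2.2 && good x.2.1 b) :=
    (hf.comp hfst).pair (Primrec.and.to_comp.comp
      (Computable.snd.comp (Computable.snd.comp Computable.snd)) (hgood.comp hfst Computable.fst))
  exact ⟨fun b => (loop b (N b)).2,
    Computable.snd.comp (Computable.nat_rec hN ((Computable.const e).pair hinit) hstep),
    fun b => (hloop b _).2⟩

/-- Unbounded search for a witness, guarded by a test that ensures its existence. -/
theorem exists_computable_search {A W : Type*} [Primcodable A] [Primcodable W]
    {guard : A → Bool} (hguard : Computable guard) {witness : A → W → Bool}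
    (hwitness : Computable₂ witness) (hex : ∀ a, guard a = true → ∃ w, witness a w = true) :
    ∃ g : A → Option W, Computable g ∧ ∀ a, (g a = none → ¬ guard a = true) ∧
      ∀ w, g a = some w → witness a w = true := by
  -- The outer `none` means that the search continues; `some none` reports a failed guard, and `some
  -- (some w)` a witness found.
  let search : A → ℕ → Option (Option W) := fun a n =>
    cond (guard a)
      ((Encodable.decode n : Option W).bind fun w =>
        cond (witness a w) (some (some w)) none)
      (some none)
  have hsearch : Computable₂ search :=
    Computable.cond (hguard.comp Computable.fst)
      (Computable.option_bind (Computable.decode.comp Computable.snd)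
        (Computable.cond (hwitness.comp (Computable.fst.comp Computable.fst) Computable.snd)
          (Computable.option_some.comp (Computable.option_some.comp Computable.snd))
          (Computable.const none)))
      (Computable.const (some none))
  have hdom : ∀ a, (Nat.rfindOpt (search a)).Dom := by
    intro a
    rw [Nat.rfindOpt_dom]
    by_cases ha : guard a = true
    · obtain ⟨w, hw⟩ := hex a ha
      exact ⟨Encodable.encode w, some w, by simp [search, ha, hw]⟩
    · exact ⟨0, none, by simp [search, ha]⟩
  refine ⟨fun a => (Nat.rfindOpt (search a)).get (hdom a),
    Partrec.of_eq_tot (Partrec.rfindOpt hsearch) fun a => Part.get_mem _, fun a => ?_⟩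
  obtain ⟨n, hn⟩ := Nat.rfindOpt_spec (Part.get_mem (hdom a))
  beta_reduce
  generalize (Nat.rfindOpt (search a)).get (hdom a) = o at hn ⊢
  by_cases ha : guard a = true
  · simp only [search, ha, cond_true, Option.mem_def, Option.bind_eq_some_iff] at hn
    obtain ⟨w, -, hw⟩ := hn
    by_cases haw : witness a w = true
    · rw [haw, cond_true] at hw
      obtain rfl := Option.some.inj hw
      refine ⟨nofun, fun v hv => ?_⟩
      rwa [← Option.some.inj hv]
    · simp [haw] at hw
  · have ho : o = none := by simpa [search, ha, eq_comm] using hn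
    subst ho
    exact ⟨fun _ => ha, nofun⟩

theorem _root_.PrimrecPred.exists_bool {A : Type*} [Primcodable A] {p : A → Prop}
    (hp : PrimrecPred p) : ∃ b : A → Bool, Primrec b ∧ ∀ a, b a = true ↔ p a := by
  classical
  exact ⟨fun a => decide (p a), hp.decide, fun a => decide_eq_true_iff⟩

variable {α : Type u} [Fintype α] [Primcodable α]

/-- The membership problem of the disappearance language is decidable. -/
theorem computablePred_disappearanceLanguage {F : Language α → Language α} {S : Language α}
    (hF : ∀ X : Language α, F X ≤ X) (hlen : IndependentlyLengthPreserving F)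
    {f : AutomatonCode (α × α) → AutomatonCode (α × α)} (hf : Computable f)
    (hfF : ∀ c, AutomatonCode.lang (f c) = uniformImage F (AutomatonCode.lang c))
    {e : AutomatonCode (α × α)} (he : e.lang = liftSnd S) :
    ∃ mem : List (α × α) → Bool, Computable mem ∧
      ∀ w, mem w = true ↔ w ∈ disappearanceLanguage F S := by
  classical
  have hiter : ∀ k, (f^[k] e).lang = liftSnd (stateSpace F S k) := by
    intro k
    induction k with
    | zero => exact he
    | succ k ih =>
      rw [Function.iterate_succ_apply', hfF, ih, uniformImage_liftSnd hlen, stateSpace_succ]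
  -- The automata `f^[k] e` read only the second component, so the first word is tested by copying
  -- it into both components.
  let diag : α × α → α × α := fun x => (x.1, x.1)
  let good : AutomatonCode (α × α) → List (α × α) → Bool := fun c w =>
    decide (w.map diag ∈ c.lang → w ∈ c.lang)
  have hdiag : Primrec fun w : List (α × α) => w.map diag :=
    Primrec.list_map Primrec.id ((Primrec.dom_finite diag).comp Primrec.snd)
  have hgood : Primrec₂ good := by
    refine PrimrecPred.decide (p := fun x : AutomatonCode (α × α) × List (α × α) =>
      (x.2.map diag ∈ x.1.lang → x.2 ∈ x.1.lang)) ?_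
    refine ((AutomatonCode.primrecRel_mem_lang.comp Primrec.fst
      (hdiag.comp Primrec.snd)).not.or AutomatonCode.primrecRel_mem_lang).of_eq fun x => ?_
    exact imp_iff_not_or.symm
  have hinit : Primrec fun w : List (α × α) => decide (w.map diag ∈ e.lang ∧ w ∈ e.lang) :=
    PrimrecPred.decide ((AutomatonCode.primrecRel_mem_lang.comp (Primrec.const e) hdiag).and
      (AutomatonCode.primrecRel_mem_lang.comp (Primrec.const e) Primrec.id))
  -- The loop runs over `k < N`, so the successor is needed to include the stage `|Σ| ^ l`.
  have hN : Primrec fun w : List (α × α) => Fintype.card α ^ w.length + 1 :=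
    Primrec.succ.comp (Primrec₂.nat_pow.comp (Primrec.const _) Primrec.list_length)
  obtain ⟨mem, hmem, hspec⟩ := exists_computable_forall_iterate hf e hgood.to_comp
    hinit.to_comp hN.to_comp
  refine ⟨mem, hmem, fun w => ?_⟩
  rw [hspec, mem_disappearanceLanguage,
    disappears_iff_forall_le hF hlen (l := w.length) (by simp) (by simp)]
  simp only [good, decide_eq_true_iff, hiter, he, mem_liftSnd, List.map_map, Function.comp_def,
    diag, and_assoc, Nat.lt_succ_iff]

/-- The equivalence queries can be answered by a computable function. -/
theorem exists_computable_equivalenceAnswer {F : Language α → Language α} {S : Language α}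
    (hF : ∀ X : Language α, F X ≤ X) (hlen : IndependentlyLengthPreserving F)
    {f : AutomatonCode (α × α) → AutomatonCode (α × α)} (hf : Computable f)
    (hfF : ∀ c, AutomatonCode.lang (f c) = uniformImage F (AutomatonCode.lang c))
    {e : AutomatonCode (α × α)} (he : e.lang = liftSnd S)
    {mem : List (α × α) → Bool} (hmem : Computable mem)
    (hmemL : ∀ w, mem w = true ↔ w ∈ disappearanceLanguage F S) :
    ∃ eqv : AutomatonCode (α × α) → Option (List (α × α)),
      Computable eqv ∧ ∀ c, IsEquivalenceAnswer F S c (eqv c) := by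
  classical
  have href : ∀ c k, Refutes F S (relOf (AutomatonCode.lang c)) k ↔
      ∃ u, u.length = k ∧ IsRefutation c (f c) e u :=
    fun c => refutes_iff_exists_isRefutation (hfF c) he
  obtain ⟨anyRef, hanyRef, hanyRef'⟩ := (primrecPred_exists_isRefutation e).exists_bool
  obtain ⟨refAt, hrefAt, hrefAt'⟩ := (primrecRel_exists_isRefutation e).exists_bool
  obtain ⟨acc, hacc, hacc'⟩ :=
    (AutomatonCode.primrecRel_mem_lang (Γ := α × α)).exists_bool
  let refuted : AutomatonCode (α × α) → Bool := fun c => anyRef (c, f c)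
  let witness : AutomatonCode (α × α) → List (α × α) → Bool := fun c w =>
    refAt (w.length, c, f c) && !(mem w == acc (c, w))
  have hpair : Computable fun c => (c, f c) := Computable.id.pair hf
  have hrefuted : Computable refuted := hanyRef.to_comp.comp hpair
  have hwitness : Computable₂ witness :=
    Primrec.and.to_comp.comp
      (hrefAt.to_comp.comp
        ((Computable.list_length.comp Computable.snd).pair (hpair.comp Computable.fst)))
      (Primrec.not.to_comp.comp (Primrec.beq.to_comp.comp (hmem.comp Computable.snd)
        hacc.to_comp))
  have hwit : ∀ c w, witness c w = true ↔ Refutes F S (relOf (AutomatonCode.lang c)) w.length ∧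
      ¬ (w ∈ c.lang ↔ mem w = true) := by
    intro c w
    have h1 : refAt (w.length, c, f c) = true ↔ _ := hrefAt' (w.length, c, f c)
    have h2 : acc (c, w) = true ↔ w ∈ c.lang := hacc' (c, w)
    rw [href, Bool.and_eq_true, h1, ← h2, Bool.not_eq_true', beq_eq_false_iff_ne]
    refine and_congr_right fun _ => not_congr ?_
    rw [Bool.eq_iff_iff]; exact iff_comm
  -- A refuting triple is not itself a counterexample, but the candidate must differ from `≼` at the
  -- same length, so the search is bound to succeed.
  have hex : ∀ c, refuted c = true → ∃ w, witness c w = true := by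
    intro c hc
    obtain ⟨u, hu⟩ := (hanyRef' (c, f c)).1 hc
    have hR := (href c u.length).2 ⟨u, rfl, hu⟩
    obtain ⟨w, hw, hne⟩ := exists_mem_not_iff_of_refutes hF hlen hR
    rw [← hmemL] at hne
    exact ⟨w, (hwit c w).2 ⟨hw ▸ hR, hne⟩⟩
  obtain ⟨eqv, heqv, hspec⟩ := exists_computable_search hrefuted hwitness hex
  refine ⟨eqv, heqv, fun c => ?_⟩
  have hc := hspec c
  cases heq : eqv c with
  | none =>
    intro k hk
    obtain ⟨u, -, hu⟩ := (href c k).1 hk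
    exact hc.1 heq ((hanyRef' (c, f c)).2 ⟨u, hu⟩)
  | some w =>
    obtain ⟨hR, hne⟩ := (hwit c w).1 (hc.2 w heq)
    exact ⟨hR, mem w, (isMembershipAnswer_iff hF hlen).2 (hmemL w), hne⟩

end ComputableOracles

end DisappearanceLearning

theorem mainTheorem3 {α : Type u} [Fintype α] [Primcodable α]
    (F : Language α → Language α) (S : Language α)
    (hS : S.IsRegular)
    (hF : ∀ X : Language α, F X ≤ X)
    (hlen : IndependentlyLengthPreserving F)
    (hreg : EffectivelyUniformlyRegular F) :
    ∃ mem : List (α × α) → Bool,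
      -- the membership oracle is implemented
      (Computable mem ∧ ∀ w, IsMembershipAnswer F S w (mem w)) ∧
      -- the equivalence oracle is implemented
      (∃ eqv : AutomatonCode (α × α) → Option (List (α × α)),
        Computable eqv ∧ ∀ c, IsEquivalenceAnswer F S c (eqv c)) ∧
      -- termination, whatever choices are made
      (TerminatesReturning mem (IsEquivalenceAnswer F S) (disappearanceLanguage F S) ↔
        (disappearanceLanguage F S).IsRegular) ∧
      -- whatever is returned is correct
      (∀ c, MayReturn mem (IsEquivalenceAnswer F S) c →
        AutomatonCode.lang c = disappearanceLanguage F S) := by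
  -- The auxiliary alphabet `α` serves both purposes: the words `s` indexing the sets `↑s`, and the
  -- dummy first component used to iterate `F` on `S`.
  obtain ⟨f, hf, hfF⟩ := hreg α
  obtain ⟨e, he⟩ := exists_code_of_isRegular (isRegular_liftSnd hS)
  obtain ⟨mem, hmem, hmemL⟩ := computablePred_disappearanceLanguage hF hlen hf hfF he
  obtain ⟨eqv, heqv, hans⟩ := exists_computable_equivalenceAnswer hF hlen hf hfF he hmem hmemL
  have hnone : ∀ c, IsEquivalenceAnswer F S c none →
      AutomatonCode.lang c = disappearanceLanguage F S :=
    fun c h => eq_disappearanceLanguage_of_not_refutes hF hlen h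
  have hsome : ∀ c w, IsEquivalenceAnswer F S c (some w) →
      ¬ (w ∈ AutomatonCode.lang c ↔ mem w = true) := by
    rintro c w ⟨-, b, hb, hne⟩
    rw [isMembershipAnswer_iff hF hlen] at hb
    rwa [hmemL, ← hb]
  exact ⟨mem, ⟨hmem, fun w => (isMembershipAnswer_iff hF hlen).2 (hmemL w)⟩,
    ⟨eqv, heqv, hans⟩,
    terminatesReturning_iff hmemL hsome hnone fun c => ⟨_, hans c⟩,
    fun c h => hnone c (equiv_none_of_mayReturn h)⟩
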